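/- Conventions. For $d\ge 3$ let $T_d$ be the $d$-regular tree; $\mathrm{Aut}(T_d)$ carries the topology of pointwise convergence on vertices. A regular legal coloring is a map $c$ from the directed edges of $T_d$ to a set $[d]$ of $d$ colors such that $c(e)=c(\bar e)$ for every directed edge $e$ and, for every vertex $v$, the restriction $c_v$ of $c$ to the set of edges with origin $v$ is a bijection onto $[d]$. For $F\le \mathrm{Sym}(d)$, the Burger--Mozes universal group is $$U(F)=U_c(F)=\{g\in\mathrm{Aut}(T_d) : c_{g(v)}\circ g\circ c_v^{-1}\in F \text{ for every vertex } v\},$$ where $c$ is any regular legal coloring. For a subgroup $G\le \mathrm{Aut}(T_d)$, $G^+$ denotes the subgroup generated by the pointwise fixators in $G$ of the edges. A permutation group acts freely if all its point stabilizers are trivial. A Frobenius group is a transitive permutation group of a finite set that does not act freely but in which the stabilizer of any two distinct points is trivial. Isomorphisms of topological groups are simultaneously homeomorphisms, and topologically simple means nontrivial with no closed normal subgroups other than the trivial one and the whole group. Theorem. Let $F\le \mathrm{Sym}(d)$ be a permutation group that does not act freely (so $d\ge 3$). Then $U(F)$ contains a compactly generated closed subgroup $H$ with a discrete normal subgroup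 $D$ such that $H/D$ is a non-discrete, totally disconnected, locally compact, compactly generated group that is simple as an abstract group, hence topologically simple, and such that $H/D$ is isomorphic to $\mathrm{Aut}(T_3)^+$ or to $U(F')^+$ for some Frobenius group $F'$. More precisely: (1) if $2$ divides the order of some point stabilizer of $F$, then $H$ and $D$ with these properties can be chosen such that $H/D\cong \mathrm{Aut}(T_3)^+$; (2) if an odd prime $p$ divides the order of some point stabilizer of $F$ and $F'\le \mathrm{Sym}(n)$ is any Frobenius group whose point stabilizers have order $p$ and index a power of two, then $H$ and $D$ with these properties can be chosen such that $H/D\cong U(F')^+$. -/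

import Mathlib

namespace BurgerMozes

universe u

/-! ### Automorphism groups of trees

A tree is a `SimpleGraph` satisfying `SimpleGraph.IsTree`. Its directed edges are its darts, edge
reversal is `SimpleGraph.Dart.symm`, and the directed edges with origin `v` are the neighbours of
`v`. The automorphism group of `T` is `T ≃g T`. -/

/-- The topology of pointwise convergence on the automorphism group of a graph, the vertex set
being discrete. A directed edge is determined by its endpoints, so this is also pointwise
convergence on vertices and directed edges. -/
instance autTopology {V : Type u} (T : SimpleGraph V) : TopologicalSpace (T ≃g T) :=
  TopologicalSpace.induced (fun g : T ≃g T => (g : V → V))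
    (@Pi.topologicalSpace V (fun _ => V) (fun _ => ⊥))

/-- The graph is `d`-regular. -/
def IsRegular {V : Type u} (T : SimpleGraph V) (d : ℕ) : Prop :=
  ∀ v, Nat.card (T.neighborSet v) = d

/-- `G⁺`, the subgroup generated by the pointwise fixators in `G` of the edges. -/
def plus {V : Type u} {T : SimpleGraph V} (G : Subgroup (T ≃g T)) : Subgroup (T ≃g T) :=
  Subgroup.closure {g | g ∈ G ∧ ∃ v w, T.Adj v w ∧ g v = v ∧ g w = w}

/-- A regular coloring of degree `d`: a map from the directed edges to `Fin d` whose restriction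
`c_v` to the set of edges with origin `v` is a bijection for every vertex `v`. -/
structure RegularColoring {V : Type u} (T : SimpleGraph V) (d : ℕ) where
  /-- the color of a directed edge -/
  color : T.Dart → Fin d
  bijective : ∀ v : V, Function.Bijective
    (fun w : T.neighborSet v => color ⟨(v, w.1), w.2⟩)

namespace RegularColoring

variable {V : Type u} {T : SimpleGraph V} {d : ℕ}

/-- A coloring is legal if an edge and its reverse have the same color. -/
def IsLegal (c : RegularColoring T d) : Prop :=
  ∀ e : T.Dart, c.color e.symm = c.color e

/-- The bijection `c_v` from the edges with origin `v` to the colors. -/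
noncomputable def atVertex (c : RegularColoring T d) (v : V) : T.neighborSet v ≃ Fin d :=
  Equiv.ofBijective _ (c.bijective v)

/-- The local action `σ_c(g, v) = c_{gv} ∘ g ∘ c_v⁻¹`. -/
noncomputable def localAction (c : RegularColoring T d) (g : T ≃g T) (v : V) :
    Equiv.Perm (Fin d) :=
  ((c.atVertex v).symm.trans (g.mapNeighborSet v)).trans (c.atVertex (g v))

theorem localAction_one (c : RegularColoring T d) (v : V) : c.localAction 1 v = 1 := by
  ext i
  have h : (SimpleGraph.Iso.mapNeighborSet (1 : T ≃g T) v) ((c.atVertex v).symm i)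
      = (c.atVertex v).symm i := rfl
  simp only [localAction, Equiv.trans_apply, Equiv.Perm.one_apply]
  rw [h]
  exact congrArg Fin.val ((c.atVertex v).apply_symm_apply i)

theorem localAction_mul (c : RegularColoring T d) (g h : T ≃g T) (v : V) :
    c.localAction (g * h) v = c.localAction g (h v) * c.localAction h v := by
  ext i
  simp only [localAction, Equiv.trans_apply, Equiv.Perm.mul_apply, Equiv.symm_apply_apply]
  rfl

end RegularColoring

/-- The Burger–Mozes group `U_c(F)`: all automorphisms whose local action at every vertex is
in `F`. -/
def universalGroup {V : Type u} {T : SimpleGraph V} {d : ℕ} (c : RegularColoring T d)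
    (F : Subgroup (Equiv.Perm (Fin d))) : Subgroup (T ≃g T) where
  carrier := {g | ∀ v, c.localAction g v ∈ F}
  one_mem' v := by
    rw [c.localAction_one]
    exact F.one_mem
  mul_mem' {g h} hg hh v := by
    rw [c.localAction_mul]
    exact F.mul_mem (hg _) (hh _)
  inv_mem' {g} hg v := by
    have h1 := c.localAction_mul g g⁻¹ v
    rw [mul_inv_cancel, c.localAction_one] at h1
    rw [eq_inv_of_mul_eq_one_right h1.symm]
    exact F.inv_mem (hg _)

/-! ### Permutation groups -/

/-- A permutation group acts freely if all its point stabilizers are trivial. -/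
def ActsFreely {n : ℕ} (F : Subgroup (Equiv.Perm (Fin n))) : Prop :=
  ∀ i : Fin n, MulAction.stabilizer F i = ⊥

/-- A Frobenius group: a transitive permutation group that does not act freely, but in which the
stabilizer of every ordered pair of distinct points is trivial. -/
structure IsFrobenius {n : ℕ} (F : Subgroup (Equiv.Perm (Fin n))) : Prop where
  transitive : MulAction.IsPretransitive F (Fin n)
  not_free : ¬ ActsFreely F
  two_point : ∀ i j : Fin n, i ≠ j → MulAction.stabilizer F i ⊓ MulAction.stabilizer F j = ⊥

/-! ### Topological groups -/

/-- A topological group is compactly generated if some compact subset generates it. -/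
def IsCompactlyGenerated (G : Type u) [Group G] [TopologicalSpace G] : Prop :=
  ∃ K : Set G, IsCompact K ∧ Subgroup.closure K = ⊤

/-- A nontrivial group whose only closed normal subgroups are the trivial one and itself. -/
def IsTopologicallySimple (G : Type u) [Group G] [TopologicalSpace G] : Prop :=
  Nontrivial G ∧ ∀ N : Subgroup G, N.Normal → IsClosed (N : Set G) → N = ⊥ ∨ N = ⊤

/-- The class `𝒮` of non-discrete totally disconnected locally compact (Hausdorff) groups that are
topologically simple and compactly generated. -/
structure InClassS (G : Type u) [Group G] [TopologicalSpace G] : Prop where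
  isTopologicalGroup : IsTopologicalGroup G
  t2 : T2Space G
  locallyCompact : LocallyCompactSpace G
  totallyDisconnected : TotallyDisconnectedSpace G
  not_discrete : ¬ DiscreteTopology G
  compactlyGenerated : IsCompactlyGenerated G
  topologicallySimple : IsTopologicallySimple G

/-- `H` is a compactly generated closed subgroup contained in `U`, `D` is a discrete normal
subgroup of `H`, and `H / D` is simple (also as an abstract group) and belongs to `𝒮`. -/
structure IsSimpleSubquotient {G : Type u} [Group G] [TopologicalSpace G] (U H : Subgroup G)
    (D : Subgroup H) [D.Normal] : Prop where
  le : H ≤ U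
  isClosed : IsClosed (H : Set G)
  compactlyGenerated : IsCompactlyGenerated H
  discrete : DiscreteTopology D
  simple : IsSimpleGroup (H ⧸ D)
  inClassS : InClassS (H ⧸ D)

end BurgerMozes

/-!
If the translates of a half-tree by the powers of an automorphism `m` are pairwise disjoint, then
every element supported on that half-tree is a commutator with `m`, through an infinite product of
conjugates by powers of `m`. A nontrivial normal subgroup of `U(F')⁺` contains such an `m`, hence
the fixators of half-trees, and these generate `U(F')⁺` if the point stabilizers of `F'` are rich
enough.

To find `U(F')⁺` inside `U(F)`, let it act on a set `X` with `d` involutions, thought of as a graph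
with colored edges, which it permutes through an `F`-valued cocycle. The developing map of the
colored tree `T` onto `X` lifts this action: the automorphisms of `T` that lie over an element of
`U(F')⁺` with local actions given by the cocycle form a closed subgroup `H` of `U(F)`, and those
over the identity form the discrete subgroup `D`. The set `X` consists of the directed edges of the
tree `T'`, with finitely many copies of each. The cocycle comes from the structure of a Frobenius
group `F'` with point stabilizers of prime order `p`: its quotient by the Frobenius kernel is
isomorphic to the group generated by a permutation of order `p` in a point stabilizer of `F`, while
permutations that commute with the kernel make `X` connected.
-/

namespace BurgerMozes

open Filter Topology
open scoped commutatorElement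

/-! ### Half-trees -/

section Tree

variable {V : Type*} {T : SimpleGraph V}

theorem forall_of_forall_adj (hT : T.Connected) {P : V → Prop} (t : V) (ht : P t)
    (hP : ∀ v w, T.Adj v w → P v → P w) (v : V) : P v := by
  obtain ⟨p⟩ := hT t v
  induction p with
  | nil => exact ht
  | cons h _ ih => exact ih (hP _ _ h ht)

theorem eq_of_adj_of_dist_lt (hT : T.IsTree) {u w x y : V} (hx : T.Adj w x) (hy : T.Adj w y)
    (hxu : T.dist u x < T.dist u w) (hyu : T.dist u y < T.dist u w) : x = y := by
  have exists_geodesic : ∀ {z}, T.Adj w z → T.dist u z < T.dist u w →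
      ∃ p : T.Walk w u, p.IsPath ∧ p.snd = z := by
    intro z hz hzu
    obtain ⟨p, hp⟩ := hT.connected.exists_walk_length_eq_dist z u
    refine ⟨.cons hz p, SimpleGraph.Walk.isPath_of_length_eq_dist _ ?_, by simp⟩
    have := hT.dist_eq_dist_add_one_of_adj u hz
    rw [T.dist_comm] at hp
    rw [SimpleGraph.Walk.length_cons, T.dist_comm]
    omega
  obtain ⟨p, hp, rfl⟩ := exists_geodesic hx hxu
  obtain ⟨q, hq, rfl⟩ := exists_geodesic hy hyu
  rw [(hT.existsUnique_path w u).unique hp hq]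

theorem exists_adj_dist_eq_dist_add_one (hT : T.IsTree) {u w : V} (h : w ≠ u) :
    ∃ x, T.Adj w x ∧ T.dist u w = T.dist u x + 1 := by
  obtain ⟨p, hp⟩ := hT.connected.exists_walk_length_eq_dist w u
  cases p with
  | nil => exact absurd rfl h
  | @cons _ x _ hx q =>
    refine ⟨x, hx, ?_⟩
    have hq : T.dist u x ≤ q.length := T.dist_comm ▸ SimpleGraph.dist_le q
    have := hT.dist_eq_dist_add_one_of_adj u hx
    rw [SimpleGraph.Walk.length_cons, T.dist_comm] at hp
    omega

theorem exists_tree_rec (hT : T.IsTree) (t : V) {X : Type*} (x : X) (κ : V → V → X → X) :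
    ∃ π : V → X, π t = x ∧
      ∀ v w, T.Adj v w → T.dist t w = T.dist t v + 1 → π w = κ v w (π v) := by
  have exists_parent : ∀ w, ∃ v, w ≠ t → T.Adj w v ∧ T.dist t w = T.dist t v + 1 := fun w => by
    by_cases h : w = t
    · exact ⟨w, fun h' => absurd h h'⟩
    · exact (exists_adj_dist_eq_dist_add_one hT h).imp fun v hv _ => hv
  choose parent hparent using exists_parent
  let f : ℕ → V → X := Nat.rec (fun _ => x) (fun _ f v => κ (parent v) v (f (parent v)))
  refine ⟨fun v => f (T.dist t v) v, by simp [f], fun v w hvw hd => ?_⟩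
  have hw : w ≠ t := by
    rintro rfl
    simp at hd
  obtain ⟨hadj, hdist⟩ := hparent w hw
  have hv : parent w = v := eq_of_adj_of_dist_lt hT (u := t) hadj hvw.symm (by omega) (by omega)
  simp only [hd]
  change κ (parent w) w (f (T.dist t v) (parent w)) = _
  rw [hv]

/-- The half-tree at the end of the directed edge from `v` to `w`: the component of `w` once the
edge is removed, described by distances. -/
def halfTree (T : SimpleGraph V) (v w : V) : Set V := {u | T.dist u w < T.dist u v}

theorem mem_halfTree {v w u : V} : u ∈ halfTree T v w ↔ T.dist u w < T.dist u v := Iff.rfl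

theorem target_mem_halfTree {v w : V} (h : T.Adj v w) : w ∈ halfTree T v w := by
  rw [mem_halfTree, SimpleGraph.dist_self, SimpleGraph.dist_eq_one_iff_adj.2 h.symm]
  exact one_pos

theorem source_notMem_halfTree (v w : V) : v ∉ halfTree T v w := by
  simp [mem_halfTree]

theorem notMem_halfTree_iff (hT : T.IsTree) {v w : V} (h : T.Adj v w) {u : V} :
    u ∉ halfTree T v w ↔ u ∈ halfTree T w v := by
  have := hT.dist_eq_dist_add_one_of_adj u h
  simp only [mem_halfTree]
  omega

theorem dist_apply (hT : T.Connected) (g : T ≃g T) (u v : V) :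
    T.dist (g u) (g v) = T.dist u v := by
  have dist_apply_le : ∀ (g : T ≃g T) u v, T.dist (g u) (g v) ≤ T.dist u v := fun g u v => by
    obtain ⟨p, hp⟩ := hT.exists_walk_length_eq_dist u v
    rw [← hp, ← SimpleGraph.Walk.length_map (g : T →g T)]
    exact SimpleGraph.dist_le _
  refine le_antisymm (dist_apply_le g u v) ?_
  simpa using dist_apply_le g.symm (g u) (g v)

theorem apply_mem_halfTree_iff (hT : T.Connected) (g : T ≃g T) {u v w : V} :
    g u ∈ halfTree T (g v) (g w) ↔ u ∈ halfTree T v w := by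
  simp only [mem_halfTree, dist_apply hT]

theorem eq_of_adj_of_mem_halfTree (hT : T.IsTree) {v w u u' : V} (h : T.Adj v w)
    (ha : T.Adj u u') (hu : u ∈ halfTree T v w) (hu' : u' ∉ halfTree T v w) :
    u = w ∧ u' = v := by
  have hdu := hT.dist_eq_dist_add_one_of_adj u h
  have hdu' := hT.dist_eq_dist_add_one_of_adj u' h
  have hdw := hT.dist_eq_dist_add_one_of_adj w ha
  have hdv := hT.dist_eq_dist_add_one_of_adj v ha
  rw [mem_halfTree] at hu hu'
  simp only [T.dist_comm (u := u), T.dist_comm (u := u')] at hdu hdu' hu hu'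
  -- Otherwise the neighbour of `u` towards `w` and `u'` are both closer to `v` than `u`, hence
  -- equal, although the latter is farther from `w` than `u`.
  have huw : u = w := by
    by_contra hne
    obtain ⟨x, hx, hdx⟩ := exists_adj_dist_eq_dist_add_one hT hne
    have hdxv := hT.dist_eq_dist_add_one_of_adj x h
    simp only [T.dist_comm (u := x)] at hdxv
    have hxu' : x = u' := eq_of_adj_of_dist_lt hT (u := v) hx ha (by omega) (by omega)
    subst hxu'
    omega
  subst huw
  rw [SimpleGraph.dist_self] at hdw
  exact ⟨rfl, (hT.connected.dist_eq_zero_iff.1 (by omega : T.dist v u' = 0)).symm⟩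

theorem disjoint_halfTree_of_ne (hT : T.IsTree) {w x y : V} (hx : T.Adj w x) (hy : T.Adj w y)
    (hxy : x ≠ y) : Disjoint (halfTree T w x) (halfTree T w y) :=
  Set.disjoint_left.2 fun _ h₁ h₂ => hxy (eq_of_adj_of_dist_lt hT hx hy h₁ h₂)

theorem halfTree_subset_of_ne (hT : T.IsTree) {v w x : V} (hv : T.Adj v w) (hx : T.Adj w x)
    (hxv : x ≠ v) : halfTree T w x ⊆ halfTree T v w := fun u hu => by
  by_contra h
  rw [notMem_halfTree_iff hT hv] at h
  exact hxv (eq_of_adj_of_dist_lt hT hx hv.symm hu h)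

theorem dist_eq_add_of_mem_halfTree (hT : T.IsTree) {v x v' u : V} (h : T.Adj v x)
    (hu : u ∈ halfTree T v x) (hv' : v' ∉ halfTree T v x) :
    T.dist u v' = T.dist u v + T.dist v v' := by
  classical
  obtain ⟨p, hp⟩ := hT.connected.exists_walk_length_eq_dist u v'
  obtain ⟨e, he, hfst, hsnd⟩ := p.exists_boundary_dart _ hu hv'
  obtain ⟨-, hv⟩ := eq_of_adj_of_mem_halfTree hT h e.adj hfst hsnd
  have hmem : v ∈ p.support := hv ▸ p.dart_snd_mem_support_of_mem_darts he
  refine le_antisymm hT.connected.dist_triangle ?_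
  rw [← hp, ← p.take_spec hmem, SimpleGraph.Walk.length_append]
  exact add_le_add (SimpleGraph.dist_le _) (SimpleGraph.dist_le _)

theorem disjoint_halfTree_of_notMem (hT : T.IsTree) {v x v' x' : V} (h : T.Adj v x)
    (h' : T.Adj v' x') (hne : v ≠ v') (hv' : v' ∉ halfTree T v x) (hv : v ∉ halfTree T v' x') :
    Disjoint (halfTree T v x) (halfTree T v' x') := by
  refine Set.disjoint_left.2 fun u hu hu' => hne ?_
  have := dist_eq_add_of_mem_halfTree hT h hu hv'
  have := dist_eq_add_of_mem_halfTree hT h' hu' hv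
  exact hT.connected.dist_eq_zero_iff.1 (by omega)

end Tree

/-! ### Legal colorings -/

namespace RegularColoring

variable {V : Type*} {T : SimpleGraph V} {d : ℕ} (c : RegularColoring T d)

/-- The neighbour of `v` along the edge of color `j`. -/
noncomputable def neighbor (v : V) (j : Fin d) : V := (c.atVertex v).symm j

theorem adj_neighbor (v : V) (j : Fin d) : T.Adj v (c.neighbor v j) := ((c.atVertex v).symm j).2

theorem color_neighbor (v : V) (j : Fin d) :
    c.color ⟨(v, c.neighbor v j), c.adj_neighbor v j⟩ = j :=
  (c.atVertex v).apply_symm_apply j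

theorem neighbor_color {v w : V} (h : T.Adj v w) : c.neighbor v (c.color ⟨(v, w), h⟩) = w :=
  congrArg Subtype.val ((c.atVertex v).symm_apply_apply ⟨w, h⟩)

theorem exists_eq_neighbor {v w : V} (h : T.Adj v w) : ∃ j, w = c.neighbor v j :=
  ⟨_, (c.neighbor_color h).symm⟩

theorem neighbor_injective (v : V) : Function.Injective (c.neighbor v) :=
  Subtype.val_injective.comp (c.atVertex v).symm.injective

theorem finite_neighborSet (c : RegularColoring T d) (v : V) : (T.neighborSet v).Finite :=
  Set.finite_coe_iff.1 (Finite.of_equiv _ (c.atVertex v).symm)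

theorem neighbor_neighbor (hc : c.IsLegal) (v : V) (j : Fin d) :
    c.neighbor (c.neighbor v j) j = v := by
  have hcolor : c.color ⟨(c.neighbor v j, v), (c.adj_neighbor v j).symm⟩ = j :=
    (hc ⟨(v, c.neighbor v j), c.adj_neighbor v j⟩).trans (c.color_neighbor v j)
  have := c.neighbor_color (c.adj_neighbor v j).symm
  rwa [hcolor] at this

theorem apply_neighbor (g : T ≃g T) (v : V) (j : Fin d) :
    g (c.neighbor v j) = c.neighbor (g v) (c.localAction g v j) := by
  simp [neighbor, localAction]

theorem localAction_eq {g : T ≃g T} {v : V} {τ : Equiv.Perm (Fin d)}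
    (h : ∀ j, g (c.neighbor v j) = c.neighbor (g v) (τ j)) : c.localAction g v = τ :=
  Equiv.ext fun j => c.neighbor_injective (g v) ((c.apply_neighbor g v j).symm.trans (h j))

theorem localAction_neighbor (hc : c.IsLegal) (g : T ≃g T) (v : V) (j : Fin d) :
    c.localAction g (c.neighbor v j) j = c.localAction g v j := by
  apply c.neighbor_injective (g (c.neighbor v j))
  rw [← c.apply_neighbor, c.neighbor_neighbor hc, c.apply_neighbor, c.neighbor_neighbor hc]

theorem exists_development (hT : T.IsTree) (hc : c.IsLegal) {X : Type*} (t : V) (x : X)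
    (κ : V → Fin d → X → X) (hκ : ∀ v j y, κ (c.neighbor v j) j (κ v j y) = y) :
    ∃ π : V → X, π t = x ∧ ∀ v j, π (c.neighbor v j) = κ v j (π v) := by
  classical
  obtain ⟨π, ht, hπ⟩ := exists_tree_rec hT t x
    (fun v w y => if h : T.Adj v w then κ v (c.color ⟨(v, w), h⟩) y else y)
  have away : ∀ v j, T.dist t (c.neighbor v j) = T.dist t v + 1 →
      π (c.neighbor v j) = κ v j (π v) := fun v j hd => by
    rw [hπ _ _ (c.adj_neighbor v j) hd, dif_pos (c.adj_neighbor v j), c.color_neighbor]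
  refine ⟨π, ht, fun v j => ?_⟩
  obtain hd | hd := hT.dist_eq_dist_add_one_of_adj t (c.adj_neighbor v j)
  · have hback := away (c.neighbor v j) j (by rwa [c.neighbor_neighbor hc])
    have hinv := hκ (c.neighbor v j) j (π (c.neighbor v j))
    rw [← hback, c.neighbor_neighbor hc] at hinv
    exact hinv.symm
  · exact away v j hd

theorem exists_iso_localAction_eq (hT : T.IsTree) (hc : c.IsLegal) (ρ : V → Equiv.Perm (Fin d))
    (hρ : ∀ v j, ρ (c.neighbor v j) j = ρ v j) (t t' : V) :
    ∃ g : T ≃g T, g t = t' ∧ ∀ v, c.localAction g v = ρ v := by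
  have hρ' : ∀ v j, (ρ (c.neighbor v ((ρ v).symm j))).symm j = (ρ v).symm j := fun v j => by
    rw [Equiv.symm_apply_eq, hρ, Equiv.apply_symm_apply]
  obtain ⟨f, hft, hf⟩ := c.exists_development hT hc t t' (fun v j y => c.neighbor y (ρ v j))
    (fun v j y => by rw [hρ, c.neighbor_neighbor hc])
  obtain ⟨f', hft', hf'⟩ := c.exists_development hT hc t' t
    (fun _ j y => c.neighbor y ((ρ y).symm j))
    (fun _ j y => by rw [hρ', c.neighbor_neighbor hc])
  have left_inv : ∀ v, f' (f v) = v := by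
    refine forall_of_forall_adj hT.connected t (by rw [hft, hft']) fun v w h hv => ?_
    obtain ⟨j, rfl⟩ := c.exists_eq_neighbor h
    rw [hf, hf', hv, Equiv.symm_apply_apply]
  have right_inv : ∀ v, f (f' v) = v := by
    refine forall_of_forall_adj hT.connected t' (by rw [hft', hft]) fun v w h hv => ?_
    obtain ⟨j, rfl⟩ := c.exists_eq_neighbor h
    rw [hf', hf, hv, Equiv.apply_symm_apply]
  have map_adj : ∀ v w, T.Adj v w → T.Adj (f v) (f w) := fun v w h => by
    obtain ⟨j, rfl⟩ := c.exists_eq_neighbor h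
    exact hf v j ▸ c.adj_neighbor _ _
  have map_adj' : ∀ v w, T.Adj v w → T.Adj (f' v) (f' w) := fun v w h => by
    obtain ⟨j, rfl⟩ := c.exists_eq_neighbor h
    exact hf' v j ▸ c.adj_neighbor _ _
  refine ⟨⟨⟨f, f', left_inv, right_inv⟩, fun {v w} => ⟨fun h => ?_, map_adj v w⟩⟩, hft,
    fun v => c.localAction_eq (hf v)⟩
  simpa only [Equiv.coe_fn_mk, left_inv] using map_adj' _ _ h

theorem exists_patch (hT : T.IsTree) (hc : c.IsLegal) (γ : V → (T ≃g T))
    (hγ : ∀ v w, T.Adj v w → γ v w = γ w w) :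
    ∃ g : T ≃g T, (∀ v, g v = γ v v) ∧ ∀ v, c.localAction g v = c.localAction (γ v) v := by
  obtain ⟨t⟩ := hT.connected.nonempty
  have compatible : ∀ v j, c.localAction (γ (c.neighbor v j)) (c.neighbor v j) j =
      c.localAction (γ v) v j := fun v j => by
    rw [c.localAction_neighbor hc]
    apply c.neighbor_injective (γ (c.neighbor v j) v)
    rw [← c.apply_neighbor, hγ _ _ (c.adj_neighbor v j).symm, ← c.apply_neighbor,
      hγ _ _ (c.adj_neighbor v j)]
  obtain ⟨g, hgt, hg⟩ := c.exists_iso_localAction_eq hT hc (fun v => c.localAction (γ v) v)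
    compatible t (γ t t)
  refine ⟨g, forall_of_forall_adj hT.connected t hgt fun v w h hv => ?_, hg⟩
  rw [← hγ v w h]
  obtain ⟨j, rfl⟩ := c.exists_eq_neighbor h
  rw [c.apply_neighbor, c.apply_neighbor, hv, hg]

end RegularColoring

/-! ### The topology of the automorphism group -/

section AutTopology

variable {V : Type*} {T : SimpleGraph V}

theorem nhds_aut (g : T ≃g T) : 𝓝 g = ⨅ v, 𝓟 {h : T ≃g T | h v = g v} := by
  let _ : TopologicalSpace V := ⊥
  have : DiscreteTopology V := ⟨rfl⟩
  change @nhds _ (TopologicalSpace.induced (fun g : T ≃g T => (g : V → V)) _) g = _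
  rw [nhds_induced, nhds_pi, Filter.pi]
  simp only [nhds_discrete, comap_iInf, comap_pure, comap_principal]
  rfl

theorem tendsto_aut {ι : Type*} {l : Filter ι} {φ : ι → (T ≃g T)} {g : T ≃g T} :
    Tendsto φ l (𝓝 g) ↔ ∀ v, ∀ᶠ i in l, φ i v = g v := by
  rw [nhds_aut]
  simp only [tendsto_iInf, tendsto_principal, Set.mem_ofPred_eq]

theorem eventually_apply_eq (g : T ≃g T) (v : V) : ∀ᶠ h in 𝓝 g, h v = g v :=
  tendsto_aut.1 tendsto_id v

theorem isLocallyConstant_apply (v : V) : IsLocallyConstant fun g : T ≃g T => g v :=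
  (IsLocallyConstant.iff_eventually_eq _).2 fun g => eventually_apply_eq g v

theorem exists_finite_of_mem_nhds {g : T ≃g T} {s : Set (T ≃g T)} (hs : s ∈ 𝓝 g) :
    ∃ A : Set V, A.Finite ∧ ∀ h : T ≃g T, (∀ v ∈ A, h v = g v) → h ∈ s := by
  rw [nhds_aut, (hasBasis_iInf_principal_finite _).mem_iff] at hs
  obtain ⟨A, hA, hs⟩ := hs
  exact ⟨A, hA, fun k hk => hs (Set.mem_iInter₂.2 hk)⟩

theorem inv_apply_eq_iff {g : T ≃g T} {v w : V} : g⁻¹ v = w ↔ v = g w :=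
  Equiv.symm_apply_eq g.toEquiv

instance isTopologicalGroup_aut : IsTopologicalGroup (T ≃g T) where
  continuous_mul := continuous_iff_continuousAt.2 fun ⟨g, h⟩ => tendsto_aut.2 fun v => by
    filter_upwards [(continuous_fst.tendsto (g, h)).eventually (eventually_apply_eq g (h v)),
      (continuous_snd.tendsto (g, h)).eventually (eventually_apply_eq h v)] with x hg hh
    rw [RelIso.mul_apply, RelIso.mul_apply, hh, hg]
  continuous_inv := continuous_iff_continuousAt.2 fun g => tendsto_aut.2 fun v => by
    filter_upwards [eventually_apply_eq g (g⁻¹ v)] with x hx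
    rw [inv_apply_eq_iff, hx, RelIso.apply_inv_self]

instance totallySeparatedSpace_aut : TotallySeparatedSpace (T ≃g T) := by
  refine totallySeparatedSpace_iff_exists_isClopen.2 fun g h hne => ?_
  obtain ⟨v, hv⟩ := DFunLike.ne_iff.1 hne
  exact ⟨{k | k v = g v}, (isLocallyConstant_apply v).isClopen_fiber (g v), rfl, Ne.symm hv⟩

theorem exists_tendsto_aut {ι : Type*} {l : Filter ι} [l.NeBot] {φ : ι → (T ≃g T)}
    (himage : ∀ v, ∃ w, ∀ᶠ i in l, φ i v = w) (hpreimage : ∀ v, ∃ w, ∀ᶠ i in l, (φ i)⁻¹ v = w) :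
    ∃ g, Tendsto φ l (𝓝 g) := by
  choose f hf using himage
  choose f' hf' using hpreimage
  have left_inv : ∀ v, f' (f v) = v := fun v => by
    obtain ⟨i, hi, hi'⟩ := ((hf v).and (hf' (f v))).exists
    rw [← hi', ← hi, RelIso.inv_apply_self]
  have right_inv : ∀ v, f (f' v) = v := fun v => by
    obtain ⟨i, hi, hi'⟩ := ((hf' v).and (hf (f' v))).exists
    rw [← hi', ← hi, RelIso.apply_inv_self]
  refine ⟨⟨⟨f, f', left_inv, right_inv⟩, fun {v w} => ?_⟩, tendsto_aut.2 hf⟩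
  obtain ⟨i, hv, hw⟩ := ((hf v).and (hf w)).exists
  change T.Adj (f v) (f w) ↔ T.Adj v w
  rw [← hv, ← hw, SimpleGraph.Iso.map_adj_iff]

theorem finite_setOf_apply (hT : T.Connected) (hfin : ∀ v, (T.neighborSet v).Finite) (a b v : V) :
    {w | ∃ g : T ≃g T, g a = b ∧ g v = w}.Finite := by
  refine forall_of_forall_adj hT (P := fun v => {w | ∃ g : T ≃g T, g a = b ∧ g v = w}.Finite) a
    ((Set.finite_singleton b).subset ?_) (fun v v' hv hfv => ?_) v
  · rintro w ⟨g, rfl, rfl⟩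
    exact Set.mem_singleton _
  · refine (hfv.biUnion fun w _ => hfin w).subset ?_
    rintro w ⟨g, hg, rfl⟩
    exact Set.mem_biUnion ⟨g, hg, rfl⟩ (g.map_adj_iff.2 hv)

theorem isCompact_setOf_apply_eq (hT : T.Connected) (hfin : ∀ v, (T.neighborSet v).Finite)
    (a b : V) : IsCompact {g : T ≃g T | g a = b} := by
  have hclosed : IsClosed {g : T ≃g T | g a = b} :=
    ((isLocallyConstant_apply a).isClopen_fiber b).1
  have eventuallyConst_of_finite : ∀ (l : Ultrafilter (T ≃g T)) (f : (T ≃g T) → V) (A : Set V),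
      A.Finite → (∀ᶠ g in l, f g ∈ A) → ∃ w, ∀ᶠ g in l, f g = w := by
    intro l f A hA hl
    have : ∀ᶠ g in l, ∃ w ∈ A, f g = w := by simpa using hl
    obtain ⟨w, -, hw⟩ := (Ultrafilter.eventually_exists_mem_iff hA).1 this
    exact ⟨w, hw⟩
  refine isCompact_iff_ultrafilter_le_nhds.2 fun l hl => ?_
  rw [le_principal_iff] at hl
  obtain ⟨g, hg⟩ := exists_tendsto_aut (l := (l : Filter (T ≃g T))) (φ := id)
    (fun v => eventuallyConst_of_finite l _ _ (finite_setOf_apply hT hfin a b v)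
      (mem_of_superset hl fun g hg => ⟨g, hg, rfl⟩))
    (fun v => eventuallyConst_of_finite l _ _ (finite_setOf_apply hT hfin b a v)
      (mem_of_superset hl fun g hg => ⟨g⁻¹, inv_apply_eq_iff.2 (Eq.symm hg), rfl⟩))
  exact ⟨g, hclosed.mem_of_tendsto hg hl, hg⟩

theorem locallyCompactSpace_aut (hT : T.Connected) (hfin : ∀ v, (T.neighborSet v).Finite) :
    LocallyCompactSpace (T ≃g T) := by
  obtain ⟨a⟩ := hT.nonempty
  exact (isCompact_setOf_apply_eq hT hfin a a).locallyCompactSpace_of_mem_nhds_of_group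
    (eventually_apply_eq 1 a)

variable {d : ℕ} (c : RegularColoring T d)

theorem isLocallyConstant_localAction (v : V) :
    IsLocallyConstant fun g : T ≃g T => c.localAction g v := by
  refine (IsLocallyConstant.iff_eventually_eq _).2 fun g => ?_
  have hneighbor : ∀ᶠ h in 𝓝 g, ∀ j, h (c.neighbor v j) = g (c.neighbor v j) :=
    eventually_all.2 fun j => eventually_apply_eq g _
  filter_upwards [eventually_apply_eq g v, hneighbor] with h hv hj
  exact c.localAction_eq fun j => by rw [hj, hv, c.apply_neighbor]

theorem isClosed_universalGroup (F : Subgroup (Equiv.Perm (Fin d))) :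
    IsClosed (universalGroup c F : Set (T ≃g T)) := by
  have : (universalGroup c F : Set (T ≃g T)) = ⋂ v, {g | c.localAction g v ∈ F} :=
    Set.ext fun _ => by simp only [Set.mem_iInter]; rfl
  rw [this]
  exact isClosed_iInter fun v => isOpen_compl_iff.1 (isLocallyConstant_localAction c v {τ | τ ∉ F})

theorem plus_le (G : Subgroup (T ≃g T)) : plus G ≤ G :=
  (Subgroup.closure_le _).2 fun _ h => h.1

theorem mem_plus {G : Subgroup (T ≃g T)} {g : T ≃g T} (hg : g ∈ G) {v w : V} (h : T.Adj v w)
    (hv : g v = v) (hw : g w = w) : g ∈ plus G :=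
  Subgroup.subset_closure ⟨hg, v, w, h, hv, hw⟩

theorem isClosed_plus {G : Subgroup (T ≃g T)} (hG : IsClosed (G : Set (T ≃g T))) {v w : V}
    (h : T.Adj v w) : IsClosed (plus G : Set (T ≃g T)) := by
  refine isClosed_of_closure_subset fun g hg => ?_
  have hgG : g ∈ G := hG.closure_subset_iff.2 (plus_le G) hg
  obtain ⟨k, ⟨hkv, hkw⟩, hk⟩ := mem_closure_iff_nhds.1 hg _
    ((eventually_apply_eq g v).and (eventually_apply_eq g w))
  have hmem : k⁻¹ * g ∈ plus G := mem_plus (G.mul_mem (G.inv_mem (plus_le G hk)) hgG) h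
    (inv_apply_eq_iff.2 hkv.symm) (inv_apply_eq_iff.2 hkw.symm)
  rw [← mul_inv_cancel_left k g]
  exact (plus G).mul_mem hk hmem

end AutTopology

/-! ### Wandering sets and commutators -/

section Wandering

variable {V : Type*} {T : SimpleGraph V} {g m : T ≃g T} {B : Set V}

/-- The positive powers of `m` move every point of `B` out of `B`; equivalently, every orbit of `m`
visits `B` at most once. -/
def IsWandering (m : T ≃g T) (B : Set V) : Prop := ∀ k : ℕ, ∀ u ∈ B, (m ^ (k + 1)) u ∉ B

theorem isWandering_of_mapsTo {A C : Set V} (hBA : B ⊆ A) (hCA : C ⊆ A) (hm : Set.MapsTo m A C)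
    (hBC : Disjoint B C) : IsWandering m B := by
  have hpow : ∀ k : ℕ, ∀ u ∈ A, (m ^ (k + 1)) u ∈ C := fun k => by
    induction k with
    | zero => simpa only [zero_add, pow_one] using fun u hu => hm hu
    | succ k ih =>
      intro u hu
      rw [pow_succ, RelIso.mul_apply]
      exact ih _ (hCA (hm hu))
  exact fun k u hu hu' => Set.disjoint_left.1 hBC hu' (hpow k u (hBA hu))

theorem IsWandering.eventually_notMem (hm : IsWandering m B) (v : V) :
    ∀ᶠ k : ℕ in atTop, (m ^ k)⁻¹ v ∉ B := by
  by_cases hv : ∃ k : ℕ, (m ^ k)⁻¹ v ∈ B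
  · obtain ⟨k, hk⟩ := hv
    filter_upwards [eventually_gt_atTop k] with l hl hB
    obtain ⟨i, rfl⟩ := Nat.exists_eq_add_of_lt hl
    refine hm i _ hB ?_
    rwa [add_assoc, pow_add m k, mul_inv_rev, RelIso.mul_apply, RelIso.apply_inv_self]
  · exact Eventually.of_forall (not_exists.1 hv)

theorem IsWandering.mul_left (hm : IsWandering m B) (hg : ∀ u ∉ B, g u = u) :
    IsWandering (g * m) B := by
  have hpow : ∀ k : ℕ, ∀ u ∈ B, ((g * m) ^ (k + 1)) u = (m ^ (k + 1)) u := fun k u hu => by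
    induction k with
    | zero =>
      simp only [zero_add, pow_one, RelIso.mul_apply]
      exact hg _ (by simpa only [zero_add, pow_one] using hm 0 u hu)
    | succ k ih =>
      rw [pow_succ', RelIso.mul_apply, ih, RelIso.mul_apply, ← RelIso.mul_apply m, ← pow_succ']
      exact hg _ (hm (k + 1) u hu)
  exact fun k u hu => hpow k u hu ▸ hm k u hu

theorem IsWandering.tendsto_conj (hm : IsWandering m B) (hg : ∀ u ∉ B, g u = u) :
    Tendsto (fun k : ℕ => m ^ k * g * (m ^ k)⁻¹) atTop (𝓝 1) := by
  refine tendsto_aut.2 fun v => (hm.eventually_notMem v).mono fun k hk => ?_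
  rw [RelIso.mul_apply, RelIso.mul_apply, hg _ hk, RelIso.apply_inv_self, RelIso.coe_one, id]

theorem IsWandering.eventuallyConst_mul_pow (hm : IsWandering m B) (hg : ∀ u ∉ B, g u = u)
    (v : V) : ∃ w, ∀ᶠ k : ℕ in atTop, ((g * m) ^ k * (m ^ k)⁻¹) v = w := by
  obtain ⟨N, hN⟩ := eventually_atTop.1 (hm.eventually_notMem v)
  refine ⟨((g * m) ^ N * (m ^ N)⁻¹) v, eventually_atTop.2 ⟨N, fun k hk => ?_⟩⟩
  induction k, hk using Nat.le_induction with
  | base => rfl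
  | succ k hk ih =>
    rw [← ih, pow_succ, pow_succ, mul_inv_rev, mul_assoc, mul_assoc, mul_inv_cancel_left,
      RelIso.mul_apply, RelIso.mul_apply, hg _ (hN k hk), RelIso.mul_apply]

/-- The infinite product `k` of the conjugates of `g` by `1, m, m², …`, which have disjoint
supports, satisfies `k = g * (m * k * m⁻¹)`. -/
theorem IsWandering.exists_commutatorElement_eq (hm : IsWandering m B) (hg : ∀ u ∉ B, g u = u)
    {P : Subgroup (T ≃g T)} (hP : IsClosed (P : Set (T ≃g T))) (hmP : m ∈ P) (hgP : g ∈ P) :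
    ∃ k ∈ P, ⁅k, m⁆ = g := by
  have hg' : ∀ u ∉ B, g⁻¹ u = u := fun u hu => inv_apply_eq_iff.2 (hg u hu).symm
  obtain ⟨k, hk⟩ : ∃ k, Tendsto (fun i : ℕ => (g * m) ^ i * (m ^ i)⁻¹) atTop (𝓝 k) := by
    refine exists_tendsto_aut (hm.eventuallyConst_mul_pow hg) fun v => ?_
    -- The inverses have the same shape, with `g⁻¹` and `g * m` in place of `g` and `m`.
    simpa only [inv_mul_cancel_left, mul_inv_rev, inv_inv] using
      (hm.mul_left hg).eventuallyConst_mul_pow hg' v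
  have hfix : k = g * m * k * m⁻¹ := by
    refine tendsto_nhds_unique (hk.comp (tendsto_add_atTop_nat 1)) ?_
    refine ((hk.const_mul (g * m)).mul_const m⁻¹).congr fun i => ?_
    simp only [Function.comp_apply]
    rw [pow_succ', pow_succ]
    group
  refine ⟨k, hP.mem_of_tendsto hk (Eventually.of_forall fun i =>
    P.mul_mem (P.pow_mem (P.mul_mem hgP hmP) i) (P.inv_mem (P.pow_mem hmP i))), ?_⟩
  rw [commutatorElement_def]
  nth_rw 1 [hfix]
  group

end Wandering

/-! ### Simplicity -/

theorem exists_notMem_union_of_subsingleton {α : Type*} (hα : 2 < ENat.card α) {s t : Set α}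
    (hs : s.Subsingleton) (ht : t.Subsingleton) : ∃ i, i ∉ s ∧ i ∉ t := by
  by_contra! hcover
  have huniv : s ∪ t = Set.univ :=
    Set.eq_univ_of_forall fun i => or_iff_not_imp_left.2 (hcover i)
  refine hα.not_ge ?_
  calc ENat.card α = (s ∪ t).encard := by rw [huniv, Set.encard_univ]
    _ ≤ s.encard + t.encard := Set.encard_union_le s t
    _ ≤ 1 + 1 := add_le_add (Set.encard_le_one_iff_subsingleton.2 hs)
        (Set.encard_le_one_iff_subsingleton.2 ht)
    _ = 2 := one_add_one_eq_two

section HalfTreeDynamics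

variable {V : Type*} {T : SimpleGraph V}

theorem apply_target_eq (hT : T.IsTree) {w y : V} (hwy : T.Adj w y) {h : T ≃g T}
    (hs : ∀ u ∉ halfTree T w y, h u = u) : h y = y := by
  have hw : h w = w := hs w (source_notMem_halfTree w y)
  have hy : h y ∈ halfTree T w y := by
    by_contra hy
    rw [h.injective (hs _ hy)] at hy
    exact hy (target_mem_halfTree hwy)
  have hadj : T.Adj (h y) (h w) := h.map_adj_iff.2 hwy.symm
  rw [hw] at hadj
  exact (eq_of_adj_of_mem_halfTree hT hwy hadj hy (source_notMem_halfTree w y)).1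

/-- Among more than two half-trees at a moved vertex `v`, at most one contains the image of `v`, and
at most one is mapped to a half-tree containing `v`. -/
theorem exists_mapsTo_compl_halfTree (hT : T.IsTree) {m : T ≃g T} {v : V} (hv : m v ≠ v)
    (hcard : 2 < ENat.card (T.neighborSet v)) :
    ∃ w, T.Adj v w ∧ Set.MapsTo m (halfTree T v w) (halfTree T w v) := by
  obtain ⟨⟨w, hw⟩, hw₁, hw₂⟩ := exists_notMem_union_of_subsingleton hcard
    (s := {w | m v ∈ halfTree T v w}) (t := {w | v ∈ halfTree T (m v) (m w)})
    (fun x hx y hy => Subtype.ext (eq_of_adj_of_dist_lt hT x.2 y.2 hx hy))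
    (fun x hx y hy => Subtype.ext (m.injective
      (eq_of_adj_of_dist_lt hT (m.map_adj_iff.2 x.2) (m.map_adj_iff.2 y.2) hx hy)))
  have hdisj := disjoint_halfTree_of_notMem hT hw (m.map_adj_iff.2 hw) hv.symm hw₁ hw₂
  refine ⟨w, hw, fun u hu => (notMem_halfTree_iff hT hw).1 fun hmu => ?_⟩
  exact Set.disjoint_left.1 hdisj hmu ((apply_mem_halfTree_iff hT.connected m).2 hu)

theorem mapsTo_halfTree_conj_mul (hT : T.IsTree) {m g : T ≃g T} {v w : V} (hvw : T.Adj v w)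
    (hm : Set.MapsTo m (halfTree T v w) (halfTree T w v)) (hgw : g w = w) (hgv : g v ≠ v) :
    Set.MapsTo (g * m * g⁻¹ * m) (halfTree T v w) (halfTree T w (g v)) := fun u hu => by
  have hgw' : g⁻¹ w = w := inv_apply_eq_iff.2 hgw.symm
  have hgv' : g⁻¹ v ≠ v := fun h => hgv (inv_apply_eq_iff.1 h).symm
  have hadj : T.Adj w (g⁻¹ v) := by
    simpa only [hgw'] using g⁻¹.map_adj_iff.2 hvw.symm
  have hback : g⁻¹ (m u) ∈ halfTree T w (g⁻¹ v) := by
    simpa only [hgw'] using (apply_mem_halfTree_iff hT.connected g⁻¹).2 (hm hu)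
  have hforth := hm (halfTree_subset_of_ne hT hvw hadj hgv' hback)
  simpa only [hgw, RelIso.mul_apply] using (apply_mem_halfTree_iff hT.connected g).2 hforth

end HalfTreeDynamics

section Simplicity

variable {V : Type*} {T : SimpleGraph V} {n : ℕ} {c : RegularColoring T n}
  {F : Subgroup (Equiv.Perm (Fin n))}

/-- The properties of a permutation group `F` behind the simplicity of `U(F)⁺`: there are at least
three points, the point stabilizers generate a transitive group, and each of them contains an
element with a single fixed point. -/
structure IsAdmissible (F : Subgroup (Equiv.Perm (Fin n))) : Prop where
  three_le : 3 ≤ n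
  transitive : ∀ i j, ∃ f ∈ Subgroup.closure {f | f ∈ F ∧ ∃ k, f k = k}, f i = j
  single : ∀ k, ∃ f ∈ F, f k = k ∧ ∀ i, i ≠ k → f i ≠ i

theorem IsAdmissible.nontrivial (hF : IsAdmissible F) : Nontrivial (Fin n) :=
  Fin.nontrivial_iff_two_le.2 (Nat.le_of_succ_le hF.three_le)

theorem IsAdmissible.exists_adj (hF : IsAdmissible F) (c : RegularColoring T n) (v : V) :
    ∃ w, T.Adj v w :=
  have := hF.nontrivial
  ⟨_, c.adj_neighbor v (Classical.arbitrary _)⟩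

theorem exists_fixing_of_mem (hT : T.IsTree) (hc : c.IsLegal) {f : Equiv.Perm (Fin n)}
    (hf : f ∈ F) {k : Fin n} (hk : f k = k) (v : V) :
    ∃ g ∈ plus (universalGroup c F), g v = v ∧ c.localAction g v = f := by
  obtain ⟨g, hgv, hg⟩ := c.exists_iso_localAction_eq hT hc (fun _ => f) (fun _ _ => rfl) v v
  refine ⟨g, mem_plus (fun u => ?_) (c.adj_neighbor v k) hgv ?_, hgv, hg v⟩
  · rwa [hg]
  · rw [c.apply_neighbor, hgv, hg, hk]

theorem exists_fixing_of_mem_closure (hT : T.IsTree) (hc : c.IsLegal) {f : Equiv.Perm (Fin n)}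
    (hf : f ∈ Subgroup.closure {f | f ∈ F ∧ ∃ k, f k = k}) (v : V) :
    ∃ g ∈ plus (universalGroup c F), g v = v ∧ c.localAction g v = f := by
  induction hf using Subgroup.closure_induction with
  | mem f hf =>
    obtain ⟨hf, k, hk⟩ := hf
    exact exists_fixing_of_mem hT hc hf hk v
  | one => exact ⟨1, one_mem _, rfl, c.localAction_one v⟩
  | mul f f' _ _ ih ih' =>
    obtain ⟨g, hg, hgv, rfl⟩ := ih
    obtain ⟨g', hg', hgv', rfl⟩ := ih'
    exact ⟨g * g', mul_mem hg hg', by rw [RelIso.mul_apply, hgv', hgv],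
      by rw [c.localAction_mul, hgv']⟩
  | inv f _ ih =>
    obtain ⟨g, hg, hgv, rfl⟩ := ih
    refine ⟨g⁻¹, inv_mem hg, inv_apply_eq_iff.2 hgv.symm, eq_inv_of_mul_eq_one_left ?_⟩
    have := c.localAction_mul g⁻¹ g v
    rwa [inv_mul_cancel, c.localAction_one, hgv, eq_comm] at this

theorem exists_rotation (hT : T.IsTree) (hc : c.IsLegal) (hF : IsAdmissible F) (v : V) {w w' : V}
    (hw : T.Adj v w) (hw' : T.Adj v w') :
    ∃ g ∈ plus (universalGroup c F), g v = v ∧ g w = w' := by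
  obtain ⟨i, rfl⟩ := c.exists_eq_neighbor hw
  obtain ⟨j, rfl⟩ := c.exists_eq_neighbor hw'
  obtain ⟨f, hf, rfl⟩ := hF.transitive i j
  obtain ⟨g, hg, hgv, rfl⟩ := exists_fixing_of_mem_closure hT hc hf v
  exact ⟨g, hg, hgv, by rw [c.apply_neighbor, hgv]⟩

theorem exists_apply_dart_eq_or_symm (hT : T.IsTree) (hc : c.IsLegal) (hF : IsAdmissible F)
    {a b : V} (hab : T.Adj a b) {v w : V} (hvw : T.Adj v w) :
    ∃ g ∈ plus (universalGroup c F), (g v = a ∧ g w = b) ∨ (g v = b ∧ g w = a) := by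
  refine forall_of_forall_adj hT.connected (P := fun v => ∀ w, T.Adj v w →
    ∃ g ∈ plus (universalGroup c F), (g v = a ∧ g w = b) ∨ (g v = b ∧ g w = a)) a ?_ ?_ v w hvw
  · intro w hw
    obtain ⟨g, hg, h⟩ := exists_rotation hT hc hF a hw hab
    exact ⟨g, hg, Or.inl h⟩
  · intro v v' hv ih w hw
    obtain ⟨g, hg, hgv', hgw⟩ := exists_rotation hT hc hF v' hw hv.symm
    obtain ⟨g', hg', h'⟩ := ih v' hv
    refine ⟨g' * g, mul_mem hg' hg, ?_⟩
    rw [RelIso.mul_apply, RelIso.mul_apply, hgv', hgw]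
    exact h'.symm.imp And.symm And.symm

theorem exists_apply_halfTree_subset (hT : T.IsTree) (hc : c.IsLegal) (hF : IsAdmissible F)
    {w y : V} (hwy : T.Adj w y) {p q : V} (hpq : T.Adj p q) :
    ∃ g ∈ plus (universalGroup c F), halfTree T (g p) (g q) ⊆ halfTree T w y := by
  have := hF.nontrivial
  obtain ⟨g, hg, ⟨rfl, rfl⟩ | ⟨rfl, rfl⟩⟩ := exists_apply_dart_eq_or_symm hT hc hF hwy hpq
  · exact ⟨g, hg, subset_rfl⟩
  · obtain ⟨j, hj⟩ := c.exists_eq_neighbor hwy.symm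
    obtain ⟨i, hi⟩ := exists_ne j
    obtain ⟨g', hg', hp, hq⟩ :=
      exists_rotation hT hc hF (g p) hwy.symm (c.adj_neighbor (g p) i)
    refine ⟨g' * g, mul_mem hg' hg, ?_⟩
    rw [RelIso.mul_apply, RelIso.mul_apply, hp, hq]
    exact halfTree_subset_of_ne hT hwy (c.adj_neighbor _ i)
      (hj ▸ (c.neighbor_injective (g p)).ne hi)

theorem exists_isWandering_halfTree (hT : T.IsTree) (hc : c.IsLegal) (hF : IsAdmissible F)
    {N : Subgroup (T ≃g T)} (hN : ∀ g ∈ plus (universalGroup c F), ∀ m ∈ N, g * m * g⁻¹ ∈ N)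
    (hne : N ≠ ⊥) : ∃ m ∈ N, ∃ w y, T.Adj w y ∧ IsWandering m (halfTree T w y) := by
  have := hF.nontrivial
  obtain ⟨m, hm, hm₁⟩ := (Subgroup.bot_or_exists_ne_one N).resolve_left hne
  obtain ⟨v, hv⟩ := DFunLike.ne_iff.1 hm₁
  obtain ⟨w, hvw, hmw⟩ := exists_mapsTo_compl_halfTree hT (m := m) hv (by
    rw [ENat.card_congr (c.atVertex v), ENat.card_eq_coe_fintype_card, Fintype.card_fin]
    exact_mod_cast hF.three_le)
  obtain ⟨i, rfl⟩ := c.exists_eq_neighbor hvw.symm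
  obtain ⟨k, hki⟩ := exists_ne i
  obtain ⟨f, hf, hfk, hfne⟩ := hF.single k
  obtain ⟨g, hg, hgw, rfl⟩ := exists_fixing_of_mem hT hc hf hfk w
  have hgv : g (c.neighbor w i) = c.neighbor w (c.localAction g w i) := by
    rw [c.apply_neighbor, hgw]
  have hgne : g (c.neighbor w i) ≠ c.neighbor w i :=
    hgv ▸ (c.neighbor_injective w).ne (hfne i hki.symm)
  have hadj : T.Adj w (g (c.neighbor w i)) := hgv ▸ c.adj_neighbor w _
  have hnek : c.neighbor w k ≠ g (c.neighbor w i) := by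
    rw [hgv, ← hfk]
    exact (c.neighbor_injective w).ne ((c.localAction g w).injective.ne hki)
  refine ⟨g * m * g⁻¹ * m, mul_mem (hN g hg m hm) hm, w, c.neighbor w k, c.adj_neighbor w k, ?_⟩
  exact isWandering_of_mapsTo
    (halfTree_subset_of_ne hT hvw (c.adj_neighbor w k) ((c.neighbor_injective w).ne hki))
    (halfTree_subset_of_ne hT hvw hadj hgne) (mapsTo_halfTree_conj_mul hT hvw hmw hgw hgne)
    (disjoint_halfTree_of_ne hT (c.adj_neighbor w k) hadj hnek)

theorem exists_restrict_halfTree (hT : T.IsTree) (hc : c.IsLegal) {g : T ≃g T}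
    (hg : g ∈ universalGroup c F) {p q : V} (hpq : T.Adj p q) (hp : g p = p) (hq : g q = q) :
    ∃ k ∈ universalGroup c F, (∀ u ∈ halfTree T p q, k u = g u) ∧
      ∀ u ∉ halfTree T p q, k u = u := by
  classical
  obtain ⟨k, hk, hk'⟩ := c.exists_patch hT hc
    (fun u => if u ∈ halfTree T p q then g else 1) (fun v w h => by
      by_cases hv : v ∈ halfTree T p q <;> by_cases hw : w ∈ halfTree T p q
      · simp [hv, hw]
      · obtain ⟨rfl, rfl⟩ := eq_of_adj_of_mem_halfTree hT hpq h hv hw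
        simpa [hv, hw] using hp
      · obtain ⟨rfl, rfl⟩ := eq_of_adj_of_mem_halfTree hT hpq h.symm hw hv
        simpa [hv, hw] using hq.symm
      · simp [hv, hw])
  refine ⟨k, fun u => ?_, fun u hu => by rw [hk, if_pos hu],
    fun u hu => by rw [hk, if_neg hu, RelIso.coe_one, id]⟩
  rw [hk']
  split_ifs
  · exact hg u
  · rw [c.localAction_one]
    exact one_mem F

theorem mem_of_isWandering (hT : T.IsTree) {N : Subgroup (T ≃g T)}
    (hNle : N ≤ plus (universalGroup c F))
    (hN : ∀ g ∈ plus (universalGroup c F), ∀ m ∈ N, g * m * g⁻¹ ∈ N) {m : T ≃g T} (hm : m ∈ N)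
    {w y : V} (hwy : T.Adj w y) (hB : IsWandering m (halfTree T w y)) {h : T ≃g T}
    (hh : h ∈ universalGroup c F) (hs : ∀ u ∉ halfTree T w y, h u = u) : h ∈ N := by
  have hplus := mem_plus hh hwy (hs w (source_notMem_halfTree w y)) (apply_target_eq hT hwy hs)
  obtain ⟨k, hk, rfl⟩ := hB.exists_commutatorElement_eq hs
    (isClosed_plus (isClosed_universalGroup c F) hwy) (hNle hm) hplus
  exact mul_mem (hN k hk m hm) (inv_mem hm)

theorem plus_le_of_forall_halfTree (hT : T.IsTree) (hc : c.IsLegal) {N : Subgroup (T ≃g T)}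
    (hN : ∀ p q, T.Adj p q → ∀ h ∈ universalGroup c F, (∀ u ∉ halfTree T p q, h u = u) → h ∈ N) :
    plus (universalGroup c F) ≤ N := by
  refine (Subgroup.closure_le _).2 ?_
  rintro g ⟨hg, p, q, hpq, hp, hq⟩
  obtain ⟨k, hk, hin, hout⟩ := exists_restrict_halfTree hT hc hg hpq hp hq
  have hkg := hN q p hpq.symm (k⁻¹ * g) (mul_mem (inv_mem hk) hg) fun u hu => by
    rw [notMem_halfTree_iff hT hpq.symm] at hu
    rw [RelIso.mul_apply, inv_apply_eq_iff, hin u hu]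
  exact mul_inv_cancel_left k g ▸ mul_mem (hN p q hpq k hk hout) hkg

theorem plus_le_of_normalized (hT : T.IsTree) (hc : c.IsLegal) (hF : IsAdmissible F)
    {N : Subgroup (T ≃g T)} (hNle : N ≤ plus (universalGroup c F))
    (hN : ∀ g ∈ plus (universalGroup c F), ∀ m ∈ N, g * m * g⁻¹ ∈ N) (hne : N ≠ ⊥) :
    plus (universalGroup c F) ≤ N := by
  obtain ⟨m, hm, w, y, hwy, hB⟩ := exists_isWandering_halfTree hT hc hF hN hne
  refine plus_le_of_forall_halfTree hT hc fun p q hpq h hh hs => ?_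
  obtain ⟨g, hg, hgs⟩ := exists_apply_halfTree_subset hT hc hF hwy hpq
  have hgU := plus_le _ hg
  have hconj : g * h * g⁻¹ ∈ N := by
    refine mem_of_isWandering hT hNle hN hm hwy hB
      (mul_mem (mul_mem hgU hh) (inv_mem hgU)) fun u hu => ?_
    have hu' : g⁻¹ u ∉ halfTree T p q := fun hmem => by
      have := hgs ((apply_mem_halfTree_iff hT.connected g).2 hmem)
      rw [RelIso.apply_inv_self] at this
      exact hu this
    rw [RelIso.mul_apply, RelIso.mul_apply, hs _ hu', RelIso.apply_inv_self]
  simpa [mul_assoc] using hN g⁻¹ (inv_mem hg) _ hconj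

theorem exists_supported (hT : T.IsTree) (hc : c.IsLegal) (hF : IsAdmissible F) {w y : V}
    (hwy : T.Adj w y) :
    ∃ h ∈ plus (universalGroup c F), h ≠ 1 ∧ ∀ u ∉ halfTree T w y, h u = u := by
  have := hF.nontrivial
  obtain ⟨j, rfl⟩ := c.exists_eq_neighbor hwy.symm
  obtain ⟨f, hf, hfj, hfne⟩ := hF.single j
  obtain ⟨g, hg, hgy, rfl⟩ := exists_fixing_of_mem hT hc hf hfj y
  obtain ⟨k, hk, hin, hout⟩ := exists_restrict_halfTree hT hc (plus_le _ hg) hwy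
    (by rw [c.apply_neighbor, hgy, hfj]) hgy
  refine ⟨k, mem_plus hk hwy (hout _ (source_notMem_halfTree _ y))
    (apply_target_eq hT hwy hout), ?_, hout⟩
  rintro rfl
  obtain ⟨i, hi⟩ := exists_ne j
  have hmem := halfTree_subset_of_ne hT hwy (c.adj_neighbor y i)
    ((c.neighbor_injective y).ne hi) (target_mem_halfTree (c.adj_neighbor y i))
  have := hin _ hmem
  rw [c.apply_neighbor g, hgy] at this
  exact hfne i hi (c.neighbor_injective y this).symm

theorem plus_ne_bot (hT : T.IsTree) (hc : c.IsLegal) (hF : IsAdmissible F) :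
    plus (universalGroup c F) ≠ ⊥ := by
  obtain ⟨v⟩ := hT.connected.nonempty
  obtain ⟨w, hw⟩ := hF.exists_adj c v
  obtain ⟨h, hh, hne, -⟩ := exists_supported hT hc hF hw
  exact Subgroup.ne_bot_iff_exists_ne_one.2 ⟨⟨h, hh⟩, fun h' => hne (congrArg Subtype.val h')⟩

theorem isSimpleGroup_plus (hT : T.IsTree) (hc : c.IsLegal) (hF : IsAdmissible F) :
    IsSimpleGroup (plus (universalGroup c F)) := by
  have : Nontrivial (plus (universalGroup c F)) :=
    (Subgroup.nontrivial_iff_ne_bot _).2 (plus_ne_bot hT hc hF)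
  refine ⟨fun N hN => or_iff_not_imp_left.2 fun hne => ?_⟩
  have hle := plus_le_of_normalized hT hc hF (N := N.map (plus (universalGroup c F)).subtype)
    (Subgroup.map_subtype_le N)
    (by
      rintro g hg _ ⟨m, hm, rfl⟩
      exact ⟨⟨g, hg⟩ * m * ⟨g, hg⟩⁻¹, hN.conj_mem m hm ⟨g, hg⟩, rfl⟩)
    (by rwa [Ne, Subgroup.map_eq_bot_iff_of_injective _ (Subgroup.subtype_injective _)])
  refine eq_top_iff.2 fun g _ => ?_
  obtain ⟨g', hg', he⟩ := hle g.2
  exact Subtype.ext he ▸ hg'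

theorem not_discreteTopology_plus (hT : T.IsTree) (hc : c.IsLegal) (hF : IsAdmissible F) :
    ¬ DiscreteTopology (plus (universalGroup c F)) := by
  intro hdisc
  obtain ⟨m, hm, w, y, hwy, hB⟩ := exists_isWandering_halfTree hT hc hF
    (N := plus (universalGroup c F)) (fun g hg m hm => mul_mem (mul_mem hg hm) (inv_mem hg))
    (plus_ne_bot hT hc hF)
  obtain ⟨h, hh, hne, hs⟩ := exists_supported hT hc hF hwy
  let m' : plus (universalGroup c F) := ⟨m, hm⟩
  let h' : plus (universalGroup c F) := ⟨h, hh⟩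
  have hlim : Tendsto (fun k : ℕ => m' ^ k * h' * (m' ^ k)⁻¹) atTop (𝓝 1) :=
    tendsto_subtype_rng.2 (hB.tendsto_conj hs)
  rw [nhds_discrete, tendsto_pure] at hlim
  obtain ⟨k, hk⟩ := hlim.exists
  exact hne (congrArg Subtype.val (conj_eq_one_iff.1 hk))

end Simplicity

/-! ### Frobenius groups -/

section Frobenius

open Subgroup MulAction

section SimplyTransitive

variable {α : Type*} {Q : Subgroup (Equiv.Perm α)}

/-- A regular permutation group: any two points are related by exactly one of its elements. -/
structure IsSimplyTransitive (Q : Subgroup (Equiv.Perm α)) : Prop where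
  eq_one : ∀ q ∈ Q, ∀ i, q i = i → q = 1
  exists_apply_eq : ∀ i j, ∃ q ∈ Q, q i = j

theorem IsSimplyTransitive.centralizer (hQ : IsSimplyTransitive Q) :
    IsSimplyTransitive (centralizer (Q : Set (Equiv.Perm α))) where
  eq_one ζ hζ i hi := Equiv.ext fun j => by
    obtain ⟨q, hq, rfl⟩ := hQ.exists_apply_eq i j
    rw [Equiv.Perm.one_apply, ← Equiv.Perm.mul_apply, ← mem_centralizer_iff.1 hζ q hq,
      Equiv.Perm.mul_apply, hi]
  exists_apply_eq i j := by
    have evaluation_bijective : ∀ k, Function.Bijective fun q : Q => (q : Equiv.Perm α) k :=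
      fun k => by
        refine ⟨fun q q' h => ?_, fun l => ?_⟩
        · refine (inv_mul_eq_one.1 (Subtype.ext (hQ.eq_one _ (q'⁻¹ * q).2 k ?_))).symm
          simpa [Equiv.symm_apply_eq] using h
        · obtain ⟨q, hq, h⟩ := hQ.exists_apply_eq k l
          exact ⟨⟨q, hq⟩, h⟩
    let ev : α → Q ≃ α := fun k => Equiv.ofBijective _ (evaluation_bijective k)
    have apply_ev : ∀ q : Q, ((ev i).symm.trans (ev j)) ((q : Equiv.Perm α) i) =
        (q : Equiv.Perm α) j := fun q => congrArg (ev j) ((ev i).symm_apply_apply q)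
    refine ⟨(ev i).symm.trans (ev j), mem_centralizer_iff.2 fun q hq => Equiv.ext fun k => ?_,
      apply_ev 1⟩
    obtain ⟨q', rfl⟩ := (evaluation_bijective i).surjective k
    calc q ((ev i).symm.trans (ev j) ((q' : Equiv.Perm α) i))
        = q ((q' : Equiv.Perm α) j) := congrArg q (apply_ev q')
      _ = (ev i).symm.trans (ev j) (q ((q' : Equiv.Perm α) i)) :=
        (apply_ev ((⟨q, hq⟩ : Q) * q')).symm

theorem exists_commutatorElement_eq_of_unique_fixedPoint [Finite α] {g : Equiv.Perm α} {b : α}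
    (hgQ : g ∈ normalizer (Q : Set (Equiv.Perm α))) (hgb : g b = b) (hg : ∀ i, g i = i → i = b)
    (hQ : ∀ q ∈ Q, q b = b → q = 1) {s : Equiv.Perm α} (hs : s ∈ Q) : ∃ t ∈ Q, ⁅t, g⁆ = s := by
  have fixedPointFree : MonoidHom.FixedPointFree (Q.normalizerMonoidHom ⟨g, hgQ⟩) := by
    intro t ht
    have hcomm : g * t * g⁻¹ = t := congrArg Subtype.val ht
    refine Subtype.ext (hQ t t.2 (hg _ ?_))
    rw [← Equiv.Perm.mul_apply, mul_inv_eq_iff_eq_mul.1 hcomm, Equiv.Perm.mul_apply, hgb]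
  obtain ⟨t, ht⟩ := fixedPointFree.commutatorMap_surjective ⟨s, hs⟩
  refine ⟨t, t.2, ?_⟩
  have hts : (t : Equiv.Perm α) / (g * t * g⁻¹) = s := congrArg Subtype.val ht
  rw [← hts, commutatorElement_def, div_eq_mul_inv]
  group

end SimplyTransitive

theorem mem_normalizer_centralizer {G : Type*} [Group G] {Q : Subgroup G} {g : G}
    (hg : g ∈ normalizer (Q : Set G)) :
    g ∈ normalizer (centralizer (Q : Set G) : Set G) := by
  have conj_mem : ∀ g ∈ normalizer (Q : Set G), ∀ ζ ∈ centralizer (Q : Set G),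
      g * ζ * g⁻¹ ∈ centralizer (Q : Set G) := fun g hg ζ hζ => by
    refine mem_centralizer_iff.2 fun q hq => ?_
    have hcomm := mem_centralizer_iff.1 hζ _ ((mem_normalizer_iff.1 (inv_mem hg) q).1 hq)
    rw [inv_inv] at hcomm
    calc q * (g * ζ * g⁻¹) = g * (g⁻¹ * q * g * ζ) * g⁻¹ := by group
      _ = g * (ζ * (g⁻¹ * q * g)) * g⁻¹ := by rw [hcomm]
      _ = g * ζ * g⁻¹ * q := by group
  refine mem_normalizer_iff.2 fun ζ => ⟨conj_mem g hg ζ, fun h => ?_⟩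
  simpa [mul_assoc] using conj_mem g⁻¹ (inv_mem hg) _ h

theorem coe_mem_normalizer_map_subtype {G : Type*} [Group G] {F : Subgroup G} (N : Subgroup F)
    [N.Normal] (f : F) : (f : G) ∈ normalizer (N.map F.subtype : Set G) :=
  le_normalizer_map F.subtype (mem_map_of_mem _ (normalizer_eq_top N ▸ mem_top f))

theorem eq_one_of_mem_zpowers {G α : Type*} [Group G] [MulAction G α] {σ τ : G}
    (hσ : (orderOf σ).Prime) {o : α} (ho : σ • o ≠ o) (hτ : τ ∈ zpowers σ) (hτo : τ • o = o) :
    τ = 1 := by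
  by_contra hτ₁
  have := Fact.mk hσ
  have hσ_mem := mem_zpowers_of_prime_card (Nat.card_zpowers σ) (g := ⟨τ, hτ⟩)
    (g' := ⟨σ, mem_zpowers σ⟩) fun h => hτ₁ (congrArg Subtype.val h)
  obtain ⟨m, hm⟩ := mem_zpowers_iff.1 hσ_mem
  have hτm : τ ^ m = σ := congrArg Subtype.val hm
  exact ho (hτm ▸ zpow_mem (show τ ∈ stabilizer G o from hτo) m)

/-- The part of the structure of a Frobenius group `F` with cyclic point stabilizers which is used
to let the tree of `F` act on another tree: a projection `χ` onto the cyclic group generated by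
`σ`, an element `gen` lying over `σ`, and a transitive group `Z` that commutes with the kernel of
`χ` and consists of commutators with `gen`. -/
structure KernelData {n d : ℕ} (F : Subgroup (Equiv.Perm (Fin n))) (σ : Equiv.Perm (Fin d)) where
  /-- the projection of `F` onto the group generated by `σ` -/
  χ : F →* Equiv.Perm (Fin d)
  χ_mem : ∀ f, χ f ∈ zpowers σ
  /-- an element of `F` over `σ` -/
  gen : F
  χ_gen : χ gen = σ
  /-- the centralizer of the Frobenius kernel -/
  Z : Subgroup (Equiv.Perm (Fin n))
  commute : ∀ f, χ f = 1 → ∀ ζ ∈ Z, (f : Equiv.Perm (Fin n)) * ζ = ζ * f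
  transitive : ∀ i j, ∃ ζ ∈ Z, ζ i = j
  exists_commutatorElement_eq : ∀ t ∈ Z, ∃ ζ ∈ Z, ⁅ζ, (gen : Equiv.Perm (Fin n))⁆ = t

namespace IsFrobenius

variable {n : ℕ} {F : Subgroup (Equiv.Perm (Fin n))}

theorem eq_one (hF : IsFrobenius F) {f : F} {i j : Fin n} (hij : i ≠ j) (hi : f • i = i)
    (hj : f • j = j) : f = 1 := by
  have : f ∈ stabilizer F i ⊓ stabilizer F j := ⟨hi, hj⟩
  rwa [hF.two_point i j hij, Subgroup.mem_bot] at this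

theorem normalizer_stabilizer_le (hF : IsFrobenius F) {b : Fin n} (hb : stabilizer F b ≠ ⊥) :
    normalizer (stabilizer F b : Set F) ≤ stabilizer F b := fun f hf => by
  obtain ⟨⟨h, hh⟩, hne⟩ := ne_bot_iff_exists_ne_one.1 hb
  by_contra hfb
  refine hne (Subtype.ext (hF.eq_one hfb ?_ hh))
  have := (mem_normalizer_iff.1 (inv_mem hf) h).1 hh
  rwa [inv_inv, mem_stabilizer_iff, mul_smul, mul_smul, inv_smul_eq_iff] at this

theorem not_dvd_index_stabilizer (hF : IsFrobenius F) {p : ℕ} (hp : p.Prime) {b : Fin n}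
    (hcard : Nat.card (stabilizer F b) = p) : ¬ p ∣ (stabilizer F b).index := by
  have := Fact.mk hp
  have := hF.transitive
  have hne : stabilizer F b ≠ ⊥ := fun h => hp.ne_one (by rw [← hcard, h, card_bot])
  obtain ⟨⟨h, hh⟩, hh₁⟩ := ne_bot_iff_exists_ne_one.1 hne
  have fixedPoints_eq : fixedPoints (stabilizer F b) (Fin n) = {b} := by
    refine Set.eq_singleton_iff_unique_mem.2 ⟨fun f => f.2, fun i hi => ?_⟩
    by_contra hib
    exact hh₁ (Subtype.ext (hF.eq_one hib (hi ⟨h, hh⟩) hh))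
  have hmod := (IsPGroup.of_card (n := 1) (by rw [hcard, pow_one])).card_modEq_card_fixedPoints
    (p := p) (G := stabilizer F b) (Fin n)
  rw [fixedPoints_eq, Nat.card_coe_set_eq, Set.ncard_singleton] at hmod
  rw [index_stabilizer_of_transitive, hmod.dvd_iff dvd_rfl]
  exact hp.not_dvd_one

/-- Burnside's transfer provides the Frobenius kernel, as the point stabilizers are self-normalizing
abelian Sylow subgroups. -/
theorem exists_hom_stabilizer (hF : IsFrobenius F) {p : ℕ} (hp : p.Prime)
    (hcard : ∀ i : Fin n, Nat.card (stabilizer F i) = p) (b : Fin n) :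
    ∃ χ : F →* stabilizer F b, Function.Surjective χ ∧
      IsSimplyTransitive (χ.ker.map F.subtype) := by
  have := Fact.mk hp
  have := hF.transitive
  have isPGroup : ∀ i, IsPGroup p (stabilizer F i) := fun i =>
    IsPGroup.of_card (n := 1) (by rw [hcard, pow_one])
  let P : Sylow p F := (isPGroup b).toSylow (hF.not_dvd_index_stabilizer hp (hcard b))
  have hne : stabilizer F b ≠ ⊥ := fun h => hp.ne_one (by rw [← hcard b, h, card_bot])
  have hP : normalizer (P : Set F) ≤ centralizer (P : Set F) := by
    have := isCyclic_of_prime_card (hcard b)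
    exact (hF.normalizer_stabilizer_le hne).trans (le_centralizer (stabilizer F b))
  let χ : F →* stabilizer F b := MonoidHom.transferSylow P hP
  have χ_surjective : Function.Surjective χ := fun t => by
    obtain ⟨s, hs⟩ := (P.2.powEquiv' P.not_dvd_index).surjective t
    exact ⟨s, (MonoidHom.transferSylow_eq_pow P hP s s.2).trans hs⟩
  have exists_ker_smul_eq : ∀ j, ∃ q ∈ χ.ker, q • b = j := fun j => by
    obtain ⟨f, rfl⟩ := exists_smul_eq F b j
    obtain ⟨⟨q, h⟩, rfl⟩ := (MonoidHom.ker_transferSylow_isComplement' P hP).surjective f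
    exact ⟨q, q.2, by rw [mul_smul, mem_stabilizer_iff.1 h.2]⟩
  refine ⟨χ, χ_surjective, ⟨?_, fun i j => ?_⟩⟩
  · rintro _ ⟨q, hq, rfl⟩ i hi
    rw [disjoint_def.1 (MonoidHom.ker_transferSylow_disjoint P hP _ (isPGroup i)) hq hi, map_one]
  · obtain ⟨q, hq, rfl⟩ := exists_ker_smul_eq i
    obtain ⟨q', hq', rfl⟩ := exists_ker_smul_eq j
    exact ⟨_, mem_map_of_mem _ (mul_mem hq' (inv_mem hq)), by
      exact (mul_smul q' q⁻¹ (q • b)).trans (by rw [inv_smul_smul])⟩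

theorem exists_ne_one_unique_fixedPoint (hF : IsFrobenius F) {p : ℕ} (hp : p.Prime) {b : Fin n}
    (hcard : Nat.card (stabilizer F b) = p) :
    ∃ f : F, f ≠ 1 ∧ f • b = b ∧ ∀ i, f • i = i → i = b := by
  have := (Finite.one_lt_card_iff_nontrivial (α := stabilizer F b)).1 (hcard ▸ hp.one_lt)
  obtain ⟨⟨f, hf⟩, hf₁⟩ := exists_ne (1 : stabilizer F b)
  have hf_ne : f ≠ 1 := fun h => hf₁ (Subtype.ext h)
  exact ⟨f, hf_ne, hf, fun i hi => by_contra fun hib => hf_ne (hF.eq_one hib hi hf)⟩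

theorem exists_kernelData (hF : IsFrobenius F) {p d : ℕ} (hp : p.Prime)
    (hcard : ∀ i : Fin n, Nat.card (stabilizer F i) = p) {σ : Equiv.Perm (Fin d)}
    (hσ : orderOf σ = p) : Nonempty (KernelData F σ) := by
  have := Fact.mk hp
  obtain ⟨b, -⟩ := not_forall.1 hF.not_free
  obtain ⟨χ, χ_surjective, hQ⟩ := hF.exists_hom_stabilizer hp hcard b
  let e : stabilizer F b ≃* zpowers σ :=
    mulEquivOfPrimeCardEq (hcard b) ((Nat.card_zpowers σ).trans hσ)
  obtain ⟨f, hf⟩ := χ_surjective (e.symm ⟨σ, mem_zpowers σ⟩)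
  obtain ⟨_, ⟨q, hq, rfl⟩, hqf⟩ := hQ.exists_apply_eq (f • b) b
  have χ_gen : e (χ (q * f)) = ⟨σ, mem_zpowers σ⟩ := by
    rw [map_mul, MonoidHom.mem_ker.1 hq, one_mul, hf, e.apply_symm_apply]
  have gen_unique_fixedPoint : ∀ i, (q * f) • i = i → i = b := fun i hi => by
    by_contra hib
    rw [hF.eq_one hib hi ((mul_smul q f b).trans hqf), map_one, map_one] at χ_gen
    exact hp.ne_one (hσ.symm.trans (orderOf_eq_one_iff.2 (congrArg Subtype.val χ_gen).symm))
  have gen_mem := coe_mem_normalizer_map_subtype χ.ker (q * f)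
  exact ⟨{
    χ := ((zpowers σ).subtype.comp e.toMonoidHom).comp χ
    χ_mem := fun f => (e (χ f)).2
    gen := q * f
    χ_gen := congrArg Subtype.val χ_gen
    Z := centralizer (χ.ker.map F.subtype)
    commute := fun f hf ζ hζ => mem_centralizer_iff.1 hζ f
      (mem_map_of_mem F.subtype (MonoidHom.mem_ker.2 (e.map_eq_one_iff.1 (Subtype.ext hf))))
    transitive := hQ.centralizer.exists_apply_eq
    exists_commutatorElement_eq := fun _ => exists_commutatorElement_eq_of_unique_fixedPoint
      (mem_normalizer_centralizer gen_mem) hqf gen_unique_fixedPoint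
      fun ζ hζ => hQ.centralizer.eq_one ζ hζ b }⟩

/-- Elements of the Frobenius kernel are commutators with a point-fixing element, hence products of
two point-fixing elements. -/
theorem isAdmissible (hF : IsFrobenius F) {p : ℕ} (hp : p.Prime)
    (hcard : ∀ i : Fin n, Nat.card (stabilizer F i) = p) : IsAdmissible F := by
  obtain ⟨b, -⟩ := not_forall.1 hF.not_free
  obtain ⟨χ, -, hQ⟩ := hF.exists_hom_stabilizer hp hcard b
  obtain ⟨f, hf_ne, hfb, hf⟩ := hF.exists_ne_one_unique_fixedPoint hp (hcard b)
  refine ⟨?_, fun i j => ?_, fun k => ?_⟩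
  · obtain ⟨i, hi⟩ : ∃ i, f • i ≠ i := by
      by_contra! h
      exact hf_ne (Subtype.ext (Equiv.ext h))
    have hib : i ≠ b := fun h => hi (h ▸ hfb)
    have hfib : f • i ≠ b := fun h => hib (smul_left_cancel f (h.trans hfb.symm))
    rw [Ne, Fin.ext_iff] at hi hib hfib
    omega
  · obtain ⟨q, hq, hqi⟩ := hQ.exists_apply_eq i j
    obtain ⟨_, ⟨t, -, rfl⟩, rfl⟩ := exists_commutatorElement_eq_of_unique_fixedPoint
      (coe_mem_normalizer_map_subtype χ.ker f) hfb hf (fun q hq => hQ.eq_one q hq b) hq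
    have conj_fixes : (t * f * t⁻¹) • t • b = t • b := by
      rw [mul_smul, inv_smul_smul, mul_smul, hfb]
    exact ⟨_, mul_mem (subset_closure ⟨(t * f * t⁻¹).2, t • b, conj_fixes⟩)
      (subset_closure ⟨(f⁻¹).2, b, inv_smul_eq_iff.2 hfb.symm⟩), hqi⟩
  · obtain ⟨f, -, hfk, hf⟩ := hF.exists_ne_one_unique_fixedPoint hp (hcard k)
    exact ⟨f, f.2, hfk, fun i hi hfi => hi (hf i hfi)⟩

end IsFrobenius

end Frobenius

/-! ### Compact generation -/

theorem isCompactlyGenerated_of_finite_orbits {V : Type*} {T : SimpleGraph V}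
    (hT : T.Connected) (hfin : ∀ v, (T.neighborSet v).Finite) {H : Subgroup (T ≃g T)}
    (hH : IsClosed (H : Set (T ≃g T))) {A : Set V} (hA : A.Finite)
    (horb : ∀ v, ∃ h ∈ H, ∃ a ∈ A, h a = v) : IsCompactlyGenerated H := by
  obtain ⟨v₀⟩ := hT.nonempty
  obtain ⟨-, -, a₀, ha₀, -⟩ := horb v₀
  let B : Set V := A ∪ ⋃ a ∈ A, T.neighborSet a
  have hB : B.Finite := hA.union (hA.biUnion fun a _ => hfin a)
  let K : Set H := ⋃ a ∈ A, ⋃ b ∈ B, Subtype.val ⁻¹' {g : T ≃g T | g a = b}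
  have mem_closure : ∀ (h : H) (a b : V), a ∈ A → b ∈ B → (h : T ≃g T) a = b →
      h ∈ Subgroup.closure K := fun h a b ha hb hab =>
    Subgroup.subset_closure (Set.mem_biUnion ha (Set.mem_biUnion hb hab))
  have exists_closure_apply : ∀ v, ∃ k ∈ Subgroup.closure K, ∃ a ∈ A, (k : T ≃g T) a = v := by
    refine forall_of_forall_adj hT a₀ ⟨1, one_mem _, a₀, ha₀, rfl⟩ ?_
    rintro _ v' hadj ⟨k, hk, a, ha, rfl⟩
    obtain ⟨h, hh, a', ha', hv'⟩ := horb ((k : T ≃g T)⁻¹ v')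
    have adj_a : T.Adj a (h a') := by
      rw [hv', ← (k : T ≃g T).map_adj_iff, RelIso.apply_inv_self]
      exact hadj
    have hh_closure := mem_closure ⟨h, hh⟩ a' (h a') ha' (Or.inr (Set.mem_biUnion ha adj_a)) rfl
    refine ⟨k * ⟨h, hh⟩, mul_mem hk hh_closure, a', ha', ?_⟩
    change (k : T ≃g T) (h a') = v'
    rw [hv', RelIso.apply_inv_self]
  refine ⟨K, ?_, eq_top_iff.2 fun h _ => ?_⟩
  · exact hA.isCompact_biUnion fun a _ => hB.isCompact_biUnion fun b _ =>
      hH.isClosedEmbedding_subtypeVal.isCompact_preimage (isCompact_setOf_apply_eq hT hfin a b)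
  · obtain ⟨k, hk, a, ha, hka⟩ := exists_closure_apply ((h : T ≃g T) a₀)
    have inv_mul_mem : k⁻¹ * h ∈ Subgroup.closure K :=
      mem_closure _ a₀ a ha₀ (Or.inl ha) (inv_apply_eq_iff.2 hka.symm)
    simpa only [mul_inv_cancel_left] using mul_mem hk inv_mul_mem

theorem IsCompactlyGenerated.quotient {G : Type*} [Group G] [TopologicalSpace G]
    (hG : IsCompactlyGenerated G) (N : Subgroup G) [N.Normal] : IsCompactlyGenerated (G ⧸ N) := by
  obtain ⟨K, hK, hK_top⟩ := hG
  refine ⟨QuotientGroup.mk' N '' K, hK.image QuotientGroup.continuous_mk, ?_⟩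
  rw [← MonoidHom.map_closure, hK_top, ← MonoidHom.range_eq_map]
  exact MonoidHom.range_eq_top.2 (QuotientGroup.mk'_surjective N)

/-! ### Lifting an action to the tree -/

/-- A topological group `G` acting on a set `X` with `d` involutions that are permuted by the action
through a cocycle with values in a permutation group `F`. The involutions act transitively, `G` has
finitely many orbits, and its topology is that of pointwise convergence. -/
structure CocycleAction (G : Type*) [Group G] [TopologicalSpace G] (X : Type*) [MulAction G X]
    {d : ℕ} (F : Subgroup (Equiv.Perm (Fin d))) where
  /-- the involutions -/
  ι : Fin d → X → X
  /-- the cocycle -/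
  s : G → X → Equiv.Perm (Fin d)
  nonempty : Nonempty X
  involutive : ∀ j x, ι j (ι j x) = x
  cocycle : ∀ g h x, s (g * h) x = s g (h • x) * s h x
  s_mem : ∀ g x, s g x ∈ F
  smul_ι : ∀ g j x, g • ι j x = ι (s g x j) (g • x)
  s_ι : ∀ g j x, s g (ι j x) j = s g x j
  connected : ∀ S : Set X, S.Nonempty → (∀ j, ∀ x ∈ S, ι j x ∈ S) → S = Set.univ
  faithful : ∀ g h : G, (∀ x : X, g • x = h • x) → g = h
  nhds_eq : ∀ g : G, 𝓝 g = ⨅ x : X, 𝓟 {h : G | h • x = g • x}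
  eventually_s : ∀ (g : G) (x : X), ∀ᶠ h in 𝓝 g, s h x = s g x
  complete : ∀ l : Filter G, l.NeBot → (∀ x : X, ∃ x', ∀ᶠ g in l, g • x = x') →
    (∀ x : X, ∃ x', ∀ᶠ g in l, g⁻¹ • x = x') → ∃ g, l ≤ 𝓝 g
  finite_orbits : ∃ A : Set X, A.Finite ∧ ∀ x, ∃ g : G, g • x ∈ A

namespace CocycleAction

variable {V : Type*} {T : SimpleGraph V} {d : ℕ} {c : RegularColoring T d}
  {F : Subgroup (Equiv.Perm (Fin d))} {G : Type*} [Group G] [TopologicalSpace G]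
  {X : Type*} [MulAction G X] (E : CocycleAction G X F)

theorem eventually_smul (E : CocycleAction G X F) (g : G) (x : X) :
    ∀ᶠ h in 𝓝 g, h • x = g • x := by
  rw [E.nhds_eq]
  exact mem_iInf_of_mem x (mem_principal_self _)

theorem s_one (x : X) : E.s 1 x = 1 := by
  have h := E.cocycle 1 1 x
  rw [mul_one, one_smul] at h
  exact mul_eq_left.1 h.symm

/-- A developing map: a map from the vertices of the tree onto `X` that turns crossing an edge of
color `j` into the involution `ι j`. -/
structure IsDevelopingMap (c : RegularColoring T d) (π : V → X) : Prop where
  surjective : Function.Surjective π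
  apply_neighbor : ∀ t j, π (c.neighbor t j) = E.ι j (π t)

theorem exists_isDevelopingMap (E : CocycleAction G X F) (hT : T.IsTree) (hc : c.IsLegal) :
    ∃ π : V → X, E.IsDevelopingMap c π := by
  obtain ⟨t₀⟩ := hT.connected.nonempty
  obtain ⟨x₀⟩ := E.nonempty
  obtain ⟨π, -, hπ⟩ := c.exists_development hT hc t₀ x₀ (fun _ => E.ι)
    (fun _ j x => E.involutive j x)
  refine ⟨π, ⟨Set.range_eq_univ.1 (E.connected _ ⟨π t₀, t₀, rfl⟩ ?_), hπ⟩⟩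
  rintro j _ ⟨t, rfl⟩
  exact ⟨c.neighbor t j, hπ t j⟩

/-- The automorphism `h` of the tree lies over the element `g` of the group, with respect to a
developing map `π`: it covers the action of `g`, and its local actions are given by the cocycle. -/
def IsLift (c : RegularColoring T d) (π : V → X) (h : T ≃g T) (g : G) : Prop :=
  ∀ t, π (h t) = g • π t ∧ c.localAction h t = E.s g (π t)

variable {E} {π : V → X}

theorem IsLift.one : E.IsLift c π 1 1 := fun t =>
  ⟨(one_smul G _).symm, by rw [c.localAction_one, E.s_one]⟩

theorem IsLift.mul {h h' : T ≃g T} {g g' : G} (H : E.IsLift c π h g) (H' : E.IsLift c π h' g') :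
    E.IsLift c π (h * h') (g * g') := fun t => by
  constructor
  · rw [RelIso.mul_apply, (H _).1, (H' t).1, mul_smul]
  · rw [c.localAction_mul, (H _).2, (H' t).2, (H' t).1, E.cocycle]

theorem IsLift.inv {h : T ≃g T} {g : G} (H : E.IsLift c π h g) : E.IsLift c π h⁻¹ g⁻¹ :=
    fun t => by
  have apply_inv : π (h⁻¹ t) = g⁻¹ • π t := by
    rw [eq_inv_smul_iff, ← (H _).1, RelIso.apply_inv_self]
  have localAction_mul_inv := c.localAction_mul h h⁻¹ t
  rw [mul_inv_cancel, c.localAction_one, (H _).2, apply_inv] at localAction_mul_inv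
  have s_mul_inv := E.cocycle g g⁻¹ (π t)
  rw [mul_inv_cancel, E.s_one] at s_mul_inv
  exact ⟨apply_inv, mul_left_cancel (localAction_mul_inv.symm.trans s_mul_inv)⟩

theorem IsLift.right_unique (hπ : Function.Surjective π) {h : T ≃g T} {g g' : G}
    (H : E.IsLift c π h g) (H' : E.IsLift c π h g') : g = g' :=
  E.faithful g g' fun x => by
    obtain ⟨t, rfl⟩ := hπ x
    rw [← (H t).1, ← (H' t).1]

theorem IsLift.eq_of_apply_eq (hT : T.Connected) {h k : T ≃g T} {g : G} (H : E.IsLift c π h g)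
    (K : E.IsLift c π k g) {t₀ : V} (hk : h t₀ = k t₀) : h = k :=
  RelIso.ext <| forall_of_forall_adj hT t₀ hk fun t t' htt' ht => by
    obtain ⟨j, rfl⟩ := c.exists_eq_neighbor htt'
    rw [c.apply_neighbor, c.apply_neighbor, (H t).2, (K t).2, ht]

theorem exists_isLift (hT : T.IsTree) (hc : c.IsLegal) (hπ : E.IsDevelopingMap c π)
    {g : G} {t t' : V} (h : π t' = g • π t) : ∃ k : T ≃g T, k t = t' ∧ E.IsLift c π k g := by
  obtain ⟨k, hk, hs⟩ := c.exists_iso_localAction_eq hT hc (fun v => E.s g (π v))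
    (fun v j => by rw [hπ.apply_neighbor, E.s_ι]) t t'
  refine ⟨k, hk, fun v => ⟨?_, hs v⟩⟩
  refine forall_of_forall_adj hT.connected (P := fun v => π (k v) = g • π v) t (by rw [hk, h]) ?_ v
  intro v w hvw hv
  obtain ⟨j, rfl⟩ := c.exists_eq_neighbor hvw
  rw [c.apply_neighbor, hπ.apply_neighbor, hπ.apply_neighbor, E.smul_ι, hv, hs]

/-- The group of all automorphisms of the tree lying over elements of `G`. -/
def liftGroup (E : CocycleAction G X F) (c : RegularColoring T d) (π : V → X) :
    Subgroup (T ≃g T) where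
  carrier := {h | ∃ g, E.IsLift c π h g}
  one_mem' := ⟨1, IsLift.one⟩
  mul_mem' := fun ⟨g, hg⟩ ⟨g', hg'⟩ => ⟨g * g', hg.mul hg'⟩
  inv_mem' := fun ⟨g, hg⟩ => ⟨g⁻¹, hg.inv⟩

/-- The projection of the group of lifts: as `π` is surjective and the action is faithful, a lift
lies over only one element of `G`. -/
noncomputable def proj (E : CocycleAction G X F) (c : RegularColoring T d) {π : V → X}
    (hπ : Function.Surjective π) : E.liftGroup c π →* G :=
  MonoidHom.mk' (fun h => h.2.choose) fun h h' =>
    IsLift.right_unique hπ (h * h').2.choose_spec (h.2.choose_spec.mul h'.2.choose_spec)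

variable (hπ : Function.Surjective π)

theorem isLift_proj (h : E.liftGroup c π) : E.IsLift c π h (E.proj c hπ h) := h.2.choose_spec

theorem proj_eq {h : E.liftGroup c π} {g : G} (H : E.IsLift c π h g) : E.proj c hπ h = g :=
  (isLift_proj hπ h).right_unique hπ H

theorem eventually_val_apply (h : E.liftGroup c π) (t : V) :
    ∀ᶠ k : E.liftGroup c π in 𝓝 h, (k : T ≃g T) t = (h : T ≃g T) t :=
  continuous_subtype_val.continuousAt.eventually (eventually_apply_eq (h : T ≃g T) t)

theorem continuous_proj : Continuous (E.proj c hπ) := by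
  refine continuous_iff_continuousAt.2 fun h => ?_
  rw [ContinuousAt, E.nhds_eq]
  refine tendsto_iInf.2 fun x => tendsto_principal.2 ?_
  obtain ⟨t, rfl⟩ := hπ x
  filter_upwards [eventually_val_apply h t] with k hk
  rw [← (isLift_proj hπ k t).1, ← (isLift_proj hπ h t).1, hk]

theorem isClosed_liftGroup (hπ : Function.Surjective π) :
    IsClosed (E.liftGroup c π : Set (T ≃g T)) := by
  refine isClosed_of_closure_subset fun h₀ hh₀ => ?_
  let l : Filter (E.liftGroup c π) := comap Subtype.val (𝓝 h₀)
  have hl : l.NeBot := mem_closure_iff_comap_neBot.1 hh₀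
  have hval : Tendsto (fun h : E.liftGroup c π => (h : T ≃g T)) l (𝓝 h₀) := tendsto_comap
  have eventually_apply := tendsto_aut.1 hval
  have eventually_inv_apply := tendsto_aut.1 hval.inv
  obtain ⟨g, hg⟩ := E.complete (map (E.proj c hπ) l) inferInstance
    (fun x => by
      obtain ⟨t, rfl⟩ := hπ x
      refine ⟨π (h₀ t), eventually_map.2 ?_⟩
      filter_upwards [eventually_apply t] with h hh
      rw [← (isLift_proj hπ h t).1, hh])
    (fun x => by
      obtain ⟨t, rfl⟩ := hπ x
      refine ⟨π (h₀⁻¹ t), eventually_map.2 ?_⟩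
      filter_upwards [eventually_inv_apply t] with h hh
      rw [← ((isLift_proj hπ h).inv t).1, hh])
  have eventually_smul : ∀ t, ∀ᶠ h in l, E.proj c hπ h • π t = g • π t :=
    fun t => hg (E.eventually_smul g (π t))
  have eventually_s : ∀ t, ∀ᶠ h in l, E.s (E.proj c hπ h) (π t) = E.s g (π t) :=
    fun t => hg (E.eventually_s g (π t))
  have eventually_localAction : ∀ t, ∀ᶠ h : E.liftGroup c π in l,
      c.localAction (h : T ≃g T) t = c.localAction h₀ t := fun t =>
    hval ((IsLocallyConstant.iff_eventually_eq _).1 (isLocallyConstant_localAction c t) h₀)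
  refine ⟨g, fun t => ?_⟩
  obtain ⟨h, hh, hsmul, hs, hlocal⟩ := ((eventually_apply t).and ((eventually_smul t).and
    ((eventually_s t).and (eventually_localAction t)))).exists
  exact ⟨by rw [← hh, ← hsmul, (isLift_proj hπ h t).1],
    by rw [← hlocal, ← hs, (isLift_proj hπ h t).2]⟩

theorem proj_surjective (hT : T.IsTree) (hc : c.IsLegal) (hπ : E.IsDevelopingMap c π) :
    Function.Surjective (E.proj c hπ.surjective) := fun g => by
  obtain ⟨t⟩ := hT.connected.nonempty
  obtain ⟨t', ht'⟩ := hπ.surjective (g • π t)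
  obtain ⟨h, -, hh⟩ := exists_isLift hT hc hπ ht'
  exact ⟨⟨h, g, hh⟩, proj_eq hπ.surjective hh⟩

theorem eventually_apply_eq_of_isLift (hT : T.Connected) {h : T ≃g T} {g : G}
    (H : E.IsLift c π h g) (t₀ t : V) :
    ∀ᶠ g' in 𝓝 g, ∀ k : T ≃g T, E.IsLift c π k g' → k t₀ = h t₀ → k t = h t := by
  refine forall_of_forall_adj hT (P := fun t => ∀ᶠ g' in 𝓝 g, ∀ k : T ≃g T, E.IsLift c π k g' →
    k t₀ = h t₀ → k t = h t) t₀ (Eventually.of_forall fun _ _ _ => id) ?_ t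
  intro t t' htt' ht
  obtain ⟨j, rfl⟩ := c.exists_eq_neighbor htt'
  filter_upwards [ht, E.eventually_s g (π t)] with g' hg' hs k hk hk₀
  rw [c.apply_neighbor, c.apply_neighbor, hg' k hk hk₀, (hk t).2, (H t).2, hs]

theorem isOpenMap_proj (hT : T.IsTree) (hc : c.IsLegal) (hπ : E.IsDevelopingMap c π) :
    IsOpenMap (E.proj c hπ.surjective) := by
  refine isOpenMap_iff_nhds_le.2 fun h S hS => ?_
  obtain ⟨t₀⟩ := hT.connected.nonempty
  have hlift := isLift_proj hπ.surjective h
  obtain ⟨S', hS', hsub⟩ := mem_nhds_subtype _ _ _ |>.1 (mem_map.1 hS)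
  obtain ⟨A, hA, hAS⟩ := exists_finite_of_mem_nhds hS'
  filter_upwards [(eventually_all_finite hA).2 fun t _ =>
      eventually_apply_eq_of_isLift hT.connected hlift t₀ t,
    E.eventually_smul (E.proj c hπ.surjective h) (π t₀)] with g hg hg₀
  rw [← (hlift t₀).1] at hg₀
  obtain ⟨k, hk₀, hk⟩ := exists_isLift hT hc hπ hg₀.symm
  have proj_mem : E.proj c hπ.surjective ⟨k, g, hk⟩ ∈ S :=
    hsub (hAS k fun t ht => hg t ht k hk hk₀)
  rwa [proj_eq hπ.surjective (h := ⟨k, g, hk⟩) hk] at proj_mem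

theorem discreteTopology_ker (hT : T.Connected) : DiscreteTopology (E.proj c hπ).ker := by
  obtain ⟨t₀⟩ := hT.nonempty
  refine discreteTopology_of_isOpen_singleton_one ?_
  have isOpen_stabilizer :
      IsOpen {k : (E.proj c hπ).ker | ((k : E.liftGroup c π) : T ≃g T) t₀ = t₀} :=
    ((isLocallyConstant_apply t₀).isClopen_fiber t₀).2.preimage
      (continuous_subtype_val.comp continuous_subtype_val)
  convert isOpen_stabilizer using 1
  refine Set.ext fun k => ⟨fun hk => hk ▸ rfl, fun hk => ?_⟩
  have hk_lift := isLift_proj hπ (k : E.liftGroup c π)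
  rw [MonoidHom.mem_ker.1 k.2] at hk_lift
  exact Subtype.ext (Subtype.ext (hk_lift.eq_of_apply_eq hT IsLift.one hk))

theorem liftGroup_le (c : RegularColoring T d) (π : V → X) :
    E.liftGroup c π ≤ universalGroup c F := by
  rintro h ⟨g, hg⟩ t
  rw [(hg t).2]
  exact E.s_mem g _

theorem isCompactlyGenerated_liftGroup (hT : T.IsTree) (hc : c.IsLegal)
    (hπ : E.IsDevelopingMap c π) : IsCompactlyGenerated (E.liftGroup c π) := by
  obtain ⟨A, hA, horb⟩ := E.finite_orbits
  choose f hf using hπ.surjective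
  refine isCompactlyGenerated_of_finite_orbits hT.connected c.finite_neighborSet
    (isClosed_liftGroup hπ.surjective) (hA.image f) fun t => ?_
  obtain ⟨g, hg⟩ := horb (π t)
  obtain ⟨h, hh, h_lift⟩ := exists_isLift hT hc hπ (t := t) (t' := f (g • π t)) (g := g) (hf _)
  exact ⟨h⁻¹, ⟨g⁻¹, h_lift.inv⟩, _, Set.mem_image_of_mem f hg, inv_apply_eq_iff.2 hh.symm⟩

/-- The isomorphism from the quotient of the group of lifts by the group of deck transformations of
the developing map onto `G`. -/
noncomputable def quotientEquiv (hT : T.IsTree) (hc : c.IsLegal) (hπ : E.IsDevelopingMap c π) :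
    (E.liftGroup c π ⧸ (E.proj c hπ.surjective).ker) ≃ₜ* G :=
  { QuotientGroup.quotientKerEquivOfSurjective (E.proj c hπ.surjective)
      (proj_surjective hT hc hπ) with
    continuous_toFun :=
      (QuotientGroup.isQuotientMap_mk (E.proj c hπ.surjective).ker).continuous_iff.2
        (continuous_proj hπ.surjective)
    continuous_invFun := by
      refine ((isOpenMap_proj hT hc hπ).isQuotientMap (continuous_proj hπ.surjective)
        (proj_surjective hT hc hπ)).continuous_iff.2 ?_
      convert (QuotientGroup.continuous_mk (N := (E.proj c hπ.surjective).ker)) using 1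
      ext h
      exact (QuotientGroup.quotientKerEquivOfSurjective (E.proj c hπ.surjective)
        (proj_surjective hT hc hπ)).symm_apply_eq.2 rfl }

theorem exists_isSimpleSubquotient (E : CocycleAction G X F) (hT : T.IsTree) (hc : c.IsLegal)
    [IsSimpleGroup G] [T2Space G] [LocallyCompactSpace G] [TotallyDisconnectedSpace G]
    (hG : ¬ DiscreteTopology G) :
    ∃ (H : Subgroup (T ≃g T)) (D : Subgroup H) (_ : D.Normal),
      IsSimpleSubquotient (universalGroup c F) H D ∧ Nonempty ((H ⧸ D) ≃ₜ* G) := by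
  obtain ⟨π, hπ⟩ := exists_isDevelopingMap E hT hc
  let e := quotientEquiv hT hc hπ
  have compactlyGenerated := isCompactlyGenerated_liftGroup hT hc hπ
  have isSimpleGroup : IsSimpleGroup (E.liftGroup c π ⧸ (E.proj c hπ.surjective).ker) :=
    e.toMulEquiv.isSimpleGroup
  refine ⟨E.liftGroup c π, (E.proj c hπ.surjective).ker, inferInstance,
    ⟨liftGroup_le c π, isClosed_liftGroup hπ.surjective, compactlyGenerated,
      discreteTopology_ker hπ.surjective hT.connected, isSimpleGroup, ?_⟩, ⟨e⟩⟩
  exact {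
    isTopologicalGroup := inferInstance
    t2 := e.toHomeomorph.symm.t2Space
    locallyCompact := e.toHomeomorph.isClosedEmbedding.locallyCompactSpace
    totallyDisconnected := e.toHomeomorph.symm.totallyDisconnectedSpace
    not_discrete := fun _ => hG e.toHomeomorph.symm.isEmbedding.discreteTopology
    compactlyGenerated := compactlyGenerated.quotient _
    topologicallySimple := ⟨inferInstance, fun N hN _ => hN.eq_bot_or_eq_top⟩ }

end CocycleAction

/-! ### The action on directed edges -/

/-- A condition on two sequences of permutations: a subset of the first of `M + 1` copies of `α` is
empty or everything if it spreads to a family of subsets that are matched by the permutations `ζ`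
between consecutive copies and preserved by the permutations `τ` within each copy. -/
def IsSpreading {M : ℕ} {α : Type*} (ζ τ : Fin (M + 1) → Equiv.Perm α) : Prop :=
  ∀ S : Fin (M + 1) → Set α,
    (∀ (k : Fin M) i, i ∈ S k.castSucc ↔ ζ k.castSucc i ∈ S k.succ) →
    (∀ y, ∀ i ∈ S y, τ y i ∈ S y) → (S 0).Nonempty → S 0 = Set.univ

namespace KernelData

variable {n d : ℕ} {F : Subgroup (Equiv.Perm (Fin n))} {σ : Equiv.Perm (Fin d)}
  (K : KernelData F σ)

theorem conj_eq_of_χ_apply_eq (hσ : (orderOf σ).Prime) {o : Fin d} (ho : σ o ≠ o)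
    {ζ : Equiv.Perm (Fin n)} (hζ : ζ ∈ K.Z) {f f' : F} (h : K.χ f' o = K.χ f o) :
    (f' : Equiv.Perm (Fin n)) * ζ * (f' : Equiv.Perm (Fin n))⁻¹ = f * ζ * (f⁻¹ : F) := by
  have χ_eq_one : K.χ (f'⁻¹ * f) = 1 := by
    refine eq_one_of_mem_zpowers hσ ho (K.χ_mem _) ?_
    rw [map_mul, map_inv, Equiv.Perm.smul_def, Equiv.Perm.mul_apply, Equiv.Perm.inv_eq_iff_eq, h]
  have hcomm := K.commute _ χ_eq_one ζ hζ
  simp only [Subgroup.coe_mul, Subgroup.coe_inv] at hcomm ⊢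
  calc (f' : Equiv.Perm (Fin n)) * ζ * (f' : Equiv.Perm (Fin n))⁻¹
      = f' * (ζ * ((f' : Equiv.Perm (Fin n))⁻¹ * f)) * (f : Equiv.Perm (Fin n))⁻¹ := by group
    _ = f * ζ * (f : Equiv.Perm (Fin n))⁻¹ := by rw [← hcomm]; group

theorem exists_equivariant (hσ : (orderOf σ).Prime) {o : Fin d} (ho : σ o ≠ o)
    {ζ : Equiv.Perm (Fin n)} (hζ : ζ ∈ K.Z) :
    ∃ R : Fin d → Equiv.Perm (Fin n), R o = ζ ∧
      ∀ (f : F) j, R (K.χ f j) = f * R j * (f : Equiv.Perm (Fin n))⁻¹ := by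
  classical
  let R : Fin d → Equiv.Perm (Fin n) := fun j =>
    if h : ∃ f : F, K.χ f o = j then h.choose * ζ * (h.choose : Equiv.Perm (Fin n))⁻¹ else 1
  have R_orbit : ∀ f : F, R (K.χ f o) = f * ζ * (f : Equiv.Perm (Fin n))⁻¹ := fun f => by
    have hex : ∃ f' : F, K.χ f' o = K.χ f o := ⟨f, rfl⟩
    simp only [R, dif_pos hex]
    exact K.conj_eq_of_χ_apply_eq hσ ho hζ hex.choose_spec
  refine ⟨R, by simpa using R_orbit 1, fun f j => ?_⟩
  by_cases hj : ∃ f' : F, K.χ f' o = j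
  · obtain ⟨f', rfl⟩ := hj
    rw [← Equiv.Perm.mul_apply, ← map_mul, R_orbit, R_orbit, Subgroup.coe_mul]
    group
  · have hj' : ¬ ∃ f' : F, K.χ f' o = K.χ f j := by
      rintro ⟨f', hf'⟩
      refine hj ⟨f⁻¹ * f', ?_⟩
      rw [map_mul, map_inv, Equiv.Perm.mul_apply, Equiv.Perm.inv_eq_iff_eq, hf']
    simp only [R, dif_neg hj, dif_neg hj']
    group

theorem exists_isSpreading : ∃ (M : ℕ) (ζ : Fin (M + 1) → Equiv.Perm (Fin n)),
    (∀ y, ζ y ∈ K.Z) ∧ IsSpreading ζ fun y => ⁅(ζ y)⁻¹, (K.gen : Equiv.Perm (Fin n))⁆ := by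
  choose root root_mem hroot using fun t : K.Z => K.exists_commutatorElement_eq t t.2
  obtain ⟨m, ⟨e⟩⟩ := Finite.exists_equiv_fin K.Z
  let u : ℕ → K.Z := fun k => if h : k < m then e.symm ⟨k, h⟩ else 1
  -- Each step is followed by its inverse, so that every even copy is matched with the first one
  -- by the identity.
  let ζ : ℕ → Equiv.Perm (Fin n) := fun k =>
    if k % 2 = 0 then (root (u (k / 2)))⁻¹ else root (u (k / 2))
  have ζ_even : ∀ k, ζ (2 * k) = (root (u k))⁻¹ := fun k => by
    simp only [ζ, Nat.mul_mod_right, if_true, Nat.mul_div_cancel_left k two_pos]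
  have ζ_odd : ∀ k, ζ (2 * k + 1) = root (u k) := fun k => by
    simp only [ζ, show (2 * k + 1) % 2 = 1 by omega, show (2 * k + 1) / 2 = k by omega,
      one_ne_zero, if_false]
  have ζ_mem : ∀ k, ζ k ∈ K.Z := fun k => by
    unfold ζ
    split_ifs
    exacts [inv_mem (root_mem _), root_mem _]
  refine ⟨2 * m, fun y => ζ y, fun y => ζ_mem y, fun S hζ hcomm ⟨i, hi⟩ => ?_⟩
  have mem_even : ∀ k (hk : 2 * k < 2 * m + 1) i, i ∈ S 0 ↔ i ∈ S ⟨2 * k, hk⟩ := fun k => by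
    induction k with
    | zero => exact fun _ _ => Iff.rfl
    | succ k ih =>
      intro hk i
      rw [ih (by omega)]
      refine (hζ ⟨2 * k, by omega⟩ i).trans ((hζ ⟨2 * k + 1, by omega⟩ _).trans ?_)
      simp only [Fin.val_castSucc, ζ_even, ζ_odd, ← Equiv.Perm.mul_apply, mul_inv_cancel,
        Equiv.Perm.one_apply]
      rfl
  refine Set.eq_univ_of_forall fun j => ?_
  obtain ⟨t, ht, rfl⟩ := K.transitive i j
  obtain ⟨k, hk, huk⟩ : ∃ k < m, u k = ⟨t, ht⟩ := ⟨e ⟨t, ht⟩, (e ⟨t, ht⟩).2, by simp [u]⟩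
  have apply_mem := hcomm ⟨2 * k, by omega⟩ i ((mem_even k _ i).1 hi)
  simp only [ζ_even, inv_inv, huk, hroot] at apply_mem
  exact (mem_even k _ _).2 apply_mem

variable {W : Type*} {T : SimpleGraph W} {c : RegularColoring T n}

/-- The cocycle on the group `U(F)⁺` obtained by projecting the local actions to the cyclic group
generated by `σ`. -/
noncomputable def cocycle (g : plus (universalGroup c F)) (v : W) : Equiv.Perm (Fin d) :=
  K.χ ⟨c.localAction (g : T ≃g T) v, plus_le _ g.2 v⟩

theorem cocycle_mem (g : plus (universalGroup c F)) (v : W) :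
    K.cocycle g v ∈ Subgroup.zpowers σ :=
  K.χ_mem _

theorem cocycle_mul (g h : plus (universalGroup c F)) (v : W) :
    K.cocycle (g * h) v = K.cocycle g ((h : T ≃g T) v) * K.cocycle h v := by
  rw [cocycle, cocycle, cocycle, ← map_mul]
  exact congrArg K.χ (Subtype.ext (c.localAction_mul _ _ v))

theorem cocycle_apply_eq {a : Fin d} (ha : σ a = a) (g : plus (universalGroup c F)) (v : W) :
    K.cocycle g v a = a := by
  obtain ⟨m, hm⟩ := Subgroup.mem_zpowers_iff.1 (K.cocycle_mem g v)
  rw [← hm]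
  exact zpow_mem (show σ ∈ MulAction.stabilizer (Equiv.Perm (Fin d)) a from ha) m

theorem cocycle_congr {g h : plus (universalGroup c F)} {v w : W}
    (hvw : c.localAction (g : T ≃g T) v = c.localAction (h : T ≃g T) w) :
    K.cocycle g v = K.cocycle h w :=
  congrArg K.χ (Subtype.ext hvw)

end KernelData

/-- A directed edge of a colored tree, given by its origin and its color, with a position on a
cycle of even length `2 * (M + 1)`. -/
structure Flag (W : Type*) (n M : ℕ) where
  /-- the origin of the edge -/
  vertex : W
  /-- the color of the edge -/
  color : Fin n
  /-- half the position on the cycle -/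
  level : Fin (M + 1)
  /-- the parity of the position -/
  side : Bool

namespace Flag

variable {W : Type*} {T : SimpleGraph W} {n M d : ℕ} {c : RegularColoring T n}
  {F : Subgroup (Equiv.Perm (Fin n))}

noncomputable instance : MulAction (plus (universalGroup c F)) (Flag W n M) where
  smul g x := ⟨(g : T ≃g T) x.vertex, c.localAction g x.vertex x.color, x.level, x.side⟩
  one_smul x := by
    change (⟨(1 : T ≃g T) x.vertex, c.localAction 1 x.vertex x.color, x.level, x.side⟩ :
      Flag W n M) = x
    rw [c.localAction_one]
    rfl
  mul_smul g h x := by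
    change (⟨((g : T ≃g T) * h) x.vertex, c.localAction (g * h) x.vertex x.color, x.level, x.side⟩ :
      Flag W n M) = ⟨_, _, _, _⟩
    rw [c.localAction_mul]
    rfl

theorem smul_def (g : plus (universalGroup c F)) (x : Flag W n M) :
    g • x = ⟨(g : T ≃g T) x.vertex, c.localAction g x.vertex x.color, x.level, x.side⟩ :=
  rfl

variable (c) in
/-- The origin of an edge, or its end at the last level, where the edge gets reversed. -/
noncomputable def turn (y : Fin (M + 1)) (v : W) (i : Fin n) : W :=
  if y = Fin.last M then c.neighbor v i else v

theorem turn_turn (hc : c.IsLegal) (y : Fin (M + 1)) (v : W) (i : Fin n) :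
    turn c y (turn c y v i) i = v := by
  unfold turn
  split_ifs
  exacts [c.neighbor_neighbor hc v i, rfl]

theorem apply_turn (g : T ≃g T) (y : Fin (M + 1)) (v : W) (i : Fin n) :
    g (turn c y v i) = turn c y (g v) (c.localAction g v i) := by
  unfold turn
  split_ifs
  exacts [c.apply_neighbor g v i, rfl]

theorem localAction_turn (hc : c.IsLegal) (g : T ≃g T) (y : Fin (M + 1)) (v : W) (i : Fin n) :
    c.localAction g (turn c y v i) i = c.localAction g v i := by
  unfold turn
  split_ifs
  exacts [c.localAction_neighbor hc g v i, rfl]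

variable (c) in
/-- The involutions on flags: the color `a` moves between consecutive levels, and every other color
moves between the two sides of a level. -/
noncomputable def move (a : Fin d) (R : Fin (M + 1) → Fin d → Equiv.Perm (Fin n)) (j : Fin d) :
    Flag W n M → Flag W n M
  | ⟨v, i, y, false⟩ =>
    if j = a then ⟨turn c (y - 1) v i, i, y - 1, true⟩ else ⟨v, R y j i, y, true⟩
  | ⟨v, i, y, true⟩ =>
    if j = a then ⟨turn c y v i, i, y + 1, false⟩ else ⟨v, (R y j).symm i, y, false⟩

variable {a : Fin d} {R : Fin (M + 1) → Fin d → Equiv.Perm (Fin n)}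

theorem move_move (hc : c.IsLegal) (j : Fin d) (x : Flag W n M) :
    move c a R j (move c a R j x) = x := by
  obtain ⟨v, i, y, _ | _⟩ := x <;> by_cases h : j = a <;> simp [move, h, turn_turn hc]

section Connected

variable {S : Set (Flag W n M)} (hc : c.IsLegal) (hS : ∀ j, ∀ x ∈ S, move c a R j x ∈ S)

include hc hS

theorem mem_iff_move_mem (j : Fin d) (x : Flag W n M) : x ∈ S ↔ move c a R j x ∈ S :=
  ⟨hS j x, fun h => move_move hc j x ▸ hS j _ h⟩

theorem mk_false_mem_iff (v : W) (i : Fin n) (y : Fin (M + 1)) {j : Fin d} (hj : j ≠ a) :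
    (⟨v, i, y, false⟩ : Flag W n M) ∈ S ↔ (⟨v, R y j i, y, true⟩ : Flag W n M) ∈ S := by
  rw [mem_iff_move_mem hc hS j]
  simp only [move, hj, if_false]

theorem mk_true_mem_iff (v : W) (i : Fin n) (y : Fin (M + 1)) :
    (⟨v, i, y, true⟩ : Flag W n M) ∈ S ↔
      (⟨turn c y v i, i, y + 1, false⟩ : Flag W n M) ∈ S := by
  rw [mem_iff_move_mem hc hS a]
  simp only [move, if_true]

theorem mk_castSucc_mem_iff (v : W) (i : Fin n) (k : Fin M) {j : Fin d} (hj : j ≠ a) :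
    (⟨v, i, k.castSucc, false⟩ : Flag W n M) ∈ S ↔
      (⟨v, R k.castSucc j i, k.succ, false⟩ : Flag W n M) ∈ S := by
  rw [mk_false_mem_iff hc hS v i _ hj, mk_true_mem_iff hc hS, turn,
    if_neg (Fin.castSucc_lt_last k).ne, Fin.coeSucc_eq_succ]

theorem nonempty_level_zero {o : Fin d} (ho : o ≠ a) {x : Flag W n M} (hx : x ∈ S) :
    {i | (⟨x.vertex, i, 0, false⟩ : Flag W n M) ∈ S}.Nonempty := by
  obtain ⟨v, i, y, b⟩ := x
  obtain ⟨i, hi⟩ : ∃ i, (⟨v, i, y, false⟩ : Flag W n M) ∈ S := by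
    cases b
    · exact ⟨i, hx⟩
    · refine ⟨(R y o).symm i, (mk_false_mem_iff hc hS v _ y ho).2 ?_⟩
      rwa [Equiv.apply_symm_apply]
  clear hx
  induction y using Fin.induction generalizing i with
  | zero => exact ⟨i, hi⟩
  | succ k ih =>
    refine ih ((R k.castSucc o).symm i) ((mk_castSucc_mem_iff hc hS v _ k ho).2 ?_)
    rwa [Equiv.apply_symm_apply]

theorem mem_of_level_zero {o : Fin d} (ho : o ≠ a) {v : W}
    (hv : ∀ i, (⟨v, i, 0, false⟩ : Flag W n M) ∈ S) (i : Fin n) (y : Fin (M + 1)) (b : Bool) :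
    (⟨v, i, y, b⟩ : Flag W n M) ∈ S := by
  have mem_false : ∀ y i, (⟨v, i, y, false⟩ : Flag W n M) ∈ S := fun y => by
    induction y using Fin.induction with
    | zero => exact hv
    | succ k ih =>
      intro i
      rw [← (R k.castSucc o).apply_symm_apply i]
      exact (mk_castSucc_mem_iff hc hS v _ k ho).1 (ih _)
  cases b
  · exact mem_false y i
  · rw [← (R y o).apply_symm_apply i]
    exact (mk_false_mem_iff hc hS v _ y ho).1 (mem_false y _)

theorem eq_univ_of_nonempty (hT : T.Connected) (hne : S.Nonempty) {o o' : Fin d} (ho : o ≠ a)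
    (ho' : o' ≠ a) (hR : IsSpreading (R · o) fun y => (R y o)⁻¹ * R y o') : S = Set.univ := by
  have mem_of_mem : ∀ x ∈ S, ∀ i y b, (⟨x.vertex, i, y, b⟩ : Flag W n M) ∈ S := by
    intro x hx
    refine mem_of_level_zero hc hS ho (Set.eq_univ_iff_forall.1 ?_)
    refine hR (fun y => {i | (⟨x.vertex, i, y, false⟩ : Flag W n M) ∈ S})
      (fun k i => mk_castSucc_mem_iff hc hS x.vertex i k ho) (fun y i hi => ?_)
      (nonempty_level_zero hc hS ho hx)
    refine (mk_false_mem_iff hc hS x.vertex _ y ho).2 ?_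
    rw [← Equiv.Perm.mul_apply, mul_inv_cancel_left]
    exact (mk_false_mem_iff hc hS x.vertex i y ho').1 hi
  obtain ⟨x₀, hx₀⟩ := hne
  have mem_all : ∀ v i y b, (⟨v, i, y, b⟩ : Flag W n M) ∈ S := by
    refine forall_of_forall_adj hT x₀.vertex (mem_of_mem x₀ hx₀) fun v w hvw hv => ?_
    obtain ⟨i, rfl⟩ := c.exists_eq_neighbor hvw
    have mem_turn := (mk_true_mem_iff hc hS v i (Fin.last M)).1 (hv _ _ _)
    rw [turn, if_pos rfl] at mem_turn
    exact mem_of_mem _ mem_turn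
  exact Set.eq_univ_of_forall fun x => mem_all x.vertex x.color x.level x.side

end Connected

variable {σ : Equiv.Perm (Fin d)} (K : KernelData F σ)

theorem smul_move (hc : c.IsLegal) (ha : σ a = a)
    (hR : ∀ y (f : F) j, R y (K.χ f j) = f * R y j * (f : Equiv.Perm (Fin n))⁻¹)
    (g : plus (universalGroup c F)) (j : Fin d) (x : Flag W n M) :
    g • move c a R j x = move c a R (K.cocycle g x.vertex j) (g • x) := by
  have cocycle_apply_eq_iff : K.cocycle g x.vertex j = a ↔ j = a := by
    conv_lhs => rw [← K.cocycle_apply_eq ha g x.vertex]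
    exact (K.cocycle g x.vertex).injective.eq_iff
  have hRg : ∀ y i, R y (K.cocycle g x.vertex j) (c.localAction (g : T ≃g T) x.vertex i) =
      c.localAction (g : T ≃g T) x.vertex (R y j i) := fun y i => by
    simp only [KernelData.cocycle, hR, inv_mul_cancel_right, ← Equiv.Perm.mul_apply]
  obtain ⟨v, i, y, _ | _⟩ := x <;> rw [smul_def, smul_def] <;> by_cases hj : j = a
  · simp only [move, hj, K.cocycle_apply_eq ha, if_true, apply_turn, localAction_turn hc]
  · simp only [move, hj, cocycle_apply_eq_iff, if_false, hRg]
  · simp only [move, hj, K.cocycle_apply_eq ha, if_true, apply_turn, localAction_turn hc]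
  · simp only [move, hj, cocycle_apply_eq_iff, if_false]
    congr 1
    rw [eq_comm, Equiv.symm_apply_eq, hRg, Equiv.apply_symm_apply]

theorem cocycle_move (ha : σ a = a) (g : plus (universalGroup c F)) (j : Fin d)
    (x : Flag W n M) :
    K.cocycle g (move c a R j x).vertex j = K.cocycle g x.vertex j := by
  by_cases hj : j = a
  · rw [hj, K.cocycle_apply_eq ha, K.cocycle_apply_eq ha]
  · obtain ⟨v, i, y, _ | _⟩ := x <;> simp only [move, hj, if_false]

theorem nhds_plus_eq (hn : 0 < n) (g : plus (universalGroup c F)) :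
    𝓝 g = ⨅ x : Flag W n M, 𝓟 {h : plus (universalGroup c F) | h • x = g • x} := by
  refine le_antisymm (le_iInf fun x => le_principal_iff.2 ?_) ?_
  · have eventually_localAction_eq := (IsLocallyConstant.iff_eventually_eq _).1
      (isLocallyConstant_localAction c x.vertex) (g : T ≃g T)
    filter_upwards [continuous_subtype_val.continuousAt.eventually
      ((eventually_apply_eq (g : T ≃g T) x.vertex).and eventually_localAction_eq)] with h hh
    rw [smul_def, smul_def, hh.1, hh.2]
  · rw [nhds_subtype, ← map_le_iff_le_comap]
    change Tendsto (fun h : plus (universalGroup c F) => (h : T ≃g T)) _ _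
    refine tendsto_aut.2 fun v => mem_of_superset
      (mem_iInf_of_mem ⟨v, ⟨0, hn⟩, 0, false⟩ (mem_principal_self _)) fun h hh => ?_
    exact congrArg vertex hh

theorem exists_le_nhds (hF : IsAdmissible F) (hT : T.Connected)
    (l : Filter (plus (universalGroup c F))) [l.NeBot]
    (hsmul : ∀ x : Flag W n M, ∃ x', ∀ᶠ g in l, g • x = x')
    (hsmul_inv : ∀ x : Flag W n M, ∃ x', ∀ᶠ g in l, g⁻¹ • x = x') : ∃ g, l ≤ 𝓝 g := by
  obtain ⟨v₀⟩ := hT.nonempty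
  obtain ⟨w₀, hv₀⟩ := hF.exists_adj c v₀
  have hn : 0 < n := by have := hF.three_le; omega
  have vertex_const : ∀ φ : plus (universalGroup c F) → plus (universalGroup c F),
      (∀ x : Flag W n M, ∃ x', ∀ᶠ g in l, φ g • x = x') →
      ∀ v, ∃ w, ∀ᶠ g in l, (φ g : T ≃g T) v = w := fun φ hφ v => by
    obtain ⟨x, hx⟩ := hφ ⟨v, ⟨0, hn⟩, 0, false⟩
    exact ⟨x.vertex, hx.mono fun g hg => congrArg vertex hg⟩
  obtain ⟨g, hg⟩ := exists_tendsto_aut (φ := fun g : plus (universalGroup c F) => (g : T ≃g T))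
    (vertex_const id hsmul) (vertex_const (·⁻¹) hsmul_inv)
  have g_mem : g ∈ plus (universalGroup c F) :=
    (isClosed_plus (isClosed_universalGroup c F) hv₀).mem_of_tendsto hg
      (Eventually.of_forall fun h => h.2)
  exact ⟨⟨g, g_mem⟩, tendsto_subtype_rng.2 hg⟩

theorem exists_finite_forall_exists_smul_mem (hF : IsAdmissible F) (hT : T.IsTree)
    (hc : c.IsLegal) :
    ∃ A : Set (Flag W n M), A.Finite ∧ ∀ x, ∃ g : plus (universalGroup c F), g • x ∈ A := by
  obtain ⟨v₀⟩ := hT.connected.nonempty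
  obtain ⟨w₀, hv₀⟩ := hF.exists_adj c v₀
  refine ⟨Set.range fun z : Bool × Fin n × Fin (M + 1) × Bool =>
    ⟨bif z.1 then v₀ else w₀, z.2.1, z.2.2.1, z.2.2.2⟩, Set.finite_range _, fun x => ?_⟩
  obtain ⟨g, hg, h⟩ := exists_apply_dart_eq_or_symm hT hc hF hv₀ (c.adj_neighbor x.vertex x.color)
  obtain ⟨b, hb⟩ : ∃ b, (bif b then v₀ else w₀) = g x.vertex := by
    rcases h with ⟨h, -⟩ | ⟨h, -⟩
    exacts [⟨true, h.symm⟩, ⟨false, h.symm⟩]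
  refine ⟨⟨g, hg⟩, ⟨b, c.localAction g x.vertex x.color, x.level, x.side⟩, ?_⟩
  simp only [smul_def, hb]

end Flag

namespace KernelData

variable {n d : ℕ} {F : Subgroup (Equiv.Perm (Fin d))} {F' : Subgroup (Equiv.Perm (Fin n))}
  {σ : Equiv.Perm (Fin d)} {W : Type*} {T : SimpleGraph W} {c : RegularColoring T n}

theorem exists_cocycleAction (K : KernelData F' σ) (hT : T.IsTree) (hc : c.IsLegal)
    (hF' : IsAdmissible F') (hσ_mem : σ ∈ F) (hσ : (orderOf σ).Prime) {a : Fin d} (ha : σ a = a) :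
    ∃ M : ℕ, Nonempty (CocycleAction (plus (universalGroup c F')) (Flag W n M) F) := by
  obtain ⟨o, ho⟩ : ∃ o, σ o ≠ o := by
    by_contra! h
    exact hσ.ne_one (orderOf_eq_one_iff.2 (Equiv.ext h))
  have o_ne : o ≠ a := fun h => ho (h ▸ ha)
  have apply_o_ne : σ o ≠ a := fun h => o_ne (σ.injective (h.trans ha.symm))
  have hn : 0 < n := by have := hF'.three_le; omega
  obtain ⟨v₀⟩ := hT.connected.nonempty
  obtain ⟨M, ζ, hζ, hspread⟩ := K.exists_isSpreading
  choose R R_o hR using fun y => K.exists_equivariant hσ ho (hζ y)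
  have R_apply_o : ∀ y, R y (σ o) = K.gen * ζ y * (K.gen : Equiv.Perm (Fin n))⁻¹ := fun y => by
    have := hR y K.gen o
    rwa [K.χ_gen, R_o] at this
  exact ⟨M, ⟨{
    ι := Flag.move c a R
    s := fun g x => K.cocycle g x.vertex
    nonempty := ⟨⟨v₀, ⟨0, hn⟩, 0, false⟩⟩
    involutive := Flag.move_move hc
    cocycle := fun g h x => K.cocycle_mul g h x.vertex
    s_mem := fun g x => Subgroup.zpowers_le.2 hσ_mem (K.cocycle_mem g x.vertex)
    smul_ι := Flag.smul_move K hc ha hR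
    s_ι := Flag.cocycle_move K ha
    connected := fun S hne hS => Flag.eq_univ_of_nonempty hc hS hT.connected hne o_ne apply_o_ne
      (by simpa only [R_apply_o, R_o, commutatorElement_def, inv_inv, mul_assoc] using hspread)
    faithful := fun g h hgh => Subtype.ext (RelIso.ext fun v =>
      congrArg Flag.vertex (hgh ⟨v, ⟨0, hn⟩, 0, false⟩))
    nhds_eq := Flag.nhds_plus_eq hn
    eventually_s := fun g x => (continuous_subtype_val.continuousAt.eventually
      ((IsLocallyConstant.iff_eventually_eq _).1 (isLocallyConstant_localAction c x.vertex)
        (g : T ≃g T))).mono fun _ => K.cocycle_congr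
    complete := fun l _ => Flag.exists_le_nhds hF' hT.connected l
    finite_orbits := Flag.exists_finite_forall_exists_smul_mem hF' hT hc }⟩⟩

end KernelData

theorem exists_isSimpleSubquotient_plus {V : Type*} {T : SimpleGraph V} (hT : T.IsTree) {d : ℕ}
    {c : RegularColoring T d} (hc : c.IsLegal) {F : Subgroup (Equiv.Perm (Fin d))} {p : ℕ}
    (hp : p.Prime) (hpF : ∃ i : Fin d, p ∣ Nat.card (MulAction.stabilizer F i))
    {n : ℕ} {F' : Subgroup (Equiv.Perm (Fin n))} (hF' : IsFrobenius F')
    (hcard : ∀ i : Fin n, Nat.card (MulAction.stabilizer F' i) = p)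
    {W : Type*} {T' : SimpleGraph W} (hT' : T'.IsTree) {c' : RegularColoring T' n}
    (hc' : c'.IsLegal) :
    ∃ (H : Subgroup (T ≃g T)) (D : Subgroup H) (_ : D.Normal),
      IsSimpleSubquotient (universalGroup c F) H D ∧
      Nonempty ((H ⧸ D) ≃ₜ* plus (universalGroup c' F')) := by
  obtain ⟨a, ha⟩ := hpF
  have := Fact.mk hp
  obtain ⟨⟨⟨σ, hσF⟩, hσa⟩, hσ⟩ := exists_prime_orderOf_dvd_card' p ha
  rw [Subgroup.orderOf_mk, Subgroup.orderOf_mk] at hσ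
  have hadm := hF'.isAdmissible hp hcard
  obtain ⟨K⟩ := hF'.exists_kernelData hp hcard hσ
  obtain ⟨M, ⟨E⟩⟩ := K.exists_cocycleAction (c := c') hT' hc' hadm hσF (hσ ▸ hp) hσa
  obtain ⟨v₀⟩ := hT'.connected.nonempty
  obtain ⟨w₀, hv₀⟩ := hadm.exists_adj c' v₀
  have := locallyCompactSpace_aut hT'.connected c'.finite_neighborSet
  have : LocallyCompactSpace (plus (universalGroup c' F')) :=
    (isClosed_plus (isClosed_universalGroup c' F') hv₀).isClosedEmbedding_subtypeVal
      |>.locallyCompactSpace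
  have := isSimpleGroup_plus hT' hc' hadm
  exact E.exists_isSimpleSubquotient hT hc (not_discreteTopology_plus hT' hc' hadm)

/-! ### Regular trees -/

theorem exists_isLegal {V : Type*} {T : SimpleGraph V} (hT : T.IsTree) {n : ℕ}
    (hn : n ≠ 0) (hreg : IsRegular T n) : ∃ c : RegularColoring T n, c.IsLegal := by
  classical
  obtain ⟨t⟩ := hT.connected.nonempty
  have exists_equiv : ∀ v, Nonempty (T.neighborSet v ≃ Fin n) := fun v => by
    have hv : Nat.card (T.neighborSet v) ≠ 0 := by rwa [hreg v]
    exact ⟨(Nat.equivFinOfCardPos hv).trans (finCongr (hreg v))⟩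
  let β := fun v => (exists_equiv v).some
  obtain ⟨τ, -, hτ⟩ := exists_tree_rec hT t (1 : Equiv.Perm (Fin n)) fun v w τ =>
    if h : T.Adj v w then Equiv.swap (β w ⟨v, h.symm⟩) (τ (β v ⟨w, h⟩)) else 1
  have color_symm : ∀ v w (h : T.Adj v w), T.dist t w = T.dist t v + 1 →
      τ w (β w ⟨v, h.symm⟩) = τ v (β v ⟨w, h⟩) := by
    intro v w h hd
    rw [hτ v w h hd, dif_pos h, Equiv.swap_apply_left]
  refine ⟨⟨fun e => τ e.fst (β e.fst ⟨e.snd, e.adj⟩), fun v => ((β v).trans (τ v)).bijective⟩,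
    fun e => ?_⟩
  rcases hT.dist_eq_dist_add_one_of_adj t e.adj with hd | hd
  · exact (color_symm e.snd e.fst e.adj.symm hd).symm
  · exact color_symm e.fst e.snd e.adj hd

/-- Words without repetition of adjacent letters. -/
def ReducedWord (n : ℕ) : Type := {l : List (Fin n) // l.IsChain (· ≠ ·)}

/-- The regular tree of reduced words, in which a word is joined to its extensions by a letter on
the left. -/
def wordTree (n : ℕ) : SimpleGraph (ReducedWord n) where
  Adj l l' := ∃ i, l'.1 = i :: l.1 ∨ l.1 = i :: l'.1
  symm := ⟨fun _ _ ⟨i, h⟩ => ⟨i, h.symm⟩⟩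
  loopless := ⟨fun l ⟨i, h⟩ => List.cons_ne_self i l.1 (h.elim id id).symm⟩

theorem wordTree_connected (n : ℕ) : (wordTree n).Connected := by
  have reachable_nil : ∀ l : ReducedWord n, (wordTree n).Reachable l ⟨[], List.isChain_nil⟩ := by
    rintro ⟨l, hl⟩
    induction l with
    | nil => exact SimpleGraph.Reachable.refl _
    | cons i l ih =>
      have hadj : (wordTree n).Adj ⟨i :: l, hl⟩ ⟨l, hl.tail⟩ := ⟨i, Or.inr rfl⟩
      exact hadj.reachable.trans (ih hl.tail)
  exact
    { preconnected := fun l l' => (reachable_nil l).trans (reachable_nil l').symm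
      nonempty := ⟨⟨[], List.isChain_nil⟩⟩ }

theorem isBridge_wordTree {n : ℕ} {l l' : ReducedWord n} {i : Fin n} (h : l'.1 = i :: l.1) :
    (wordTree n).IsBridge s(l, l') := by
  rw [SimpleGraph.isBridge_iff_forall_walk_mem_edges]
  intro p
  -- The walk must enter the set of extensions of `l'`, which only this edge allows.
  obtain ⟨e, he, hfst, hsnd⟩ := p.exists_boundary_dart {x | ¬ l'.1 <:+ x.1}
    (fun hl => by simpa [h] using hl.length_le) (by simp)
  simp only [Set.mem_ofPred_eq, not_not] at hfst hsnd
  obtain ⟨j, hj | hj⟩ := e.adj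
  · rw [hj, List.suffix_cons_iff] at hsnd
    have hl' := hsnd.resolve_right hfst
    have e_snd : e.snd = l' := Subtype.ext (hj.trans hl'.symm)
    have e_fst : e.fst = l := Subtype.ext (List.cons.inj (h.symm.trans hl')).2.symm
    have e_edge : e.edge = s(l, l') := by rw [← e_fst, ← e_snd]; rfl
    exact e_edge ▸ List.mem_map_of_mem he
  · exact absurd (hsnd.trans (hj ▸ List.suffix_cons j _)) hfst

theorem wordTree_isTree (n : ℕ) : (wordTree n).IsTree := by
  refine ⟨wordTree_connected n, SimpleGraph.isAcyclic_iff_forall_adj_isBridge.2 ?_⟩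
  rintro l l' ⟨i, h | h⟩
  · exact isBridge_wordTree h
  · exact Sym2.eq_swap ▸ isBridge_wordTree h

theorem eq_of_eq_cons_or_eq_cons {α : Type*} {l l' : List α} {i j : α}
    (hi : l' = i :: l ∨ l = i :: l') (hj : l' = j :: l ∨ l = j :: l') : i = j := by
  rcases hi with rfl | rfl <;> rcases hj with hj | hj
  · exact (List.cons.inj hj).1
  · exact absurd (congrArg List.length hj) (by simp; omega)
  · exact absurd (congrArg List.length hj) (by simp; omega)
  · exact (List.cons.inj hj).1

theorem existsUnique_eq_cons_or_eq_cons {n : ℕ} (l : ReducedWord n) (i : Fin n) :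
    ∃! l' : ReducedWord n, l'.1 = i :: l.1 ∨ l.1 = i :: l'.1 := by
  by_cases h : ∃ l₀, l.1 = i :: l₀
  · obtain ⟨l₀, h⟩ := h
    have hl := l.2
    rw [h] at hl
    refine ⟨⟨l₀, hl.tail⟩, Or.inr h, ?_⟩
    rintro l' (h' | h')
    · have hl' := l'.2
      rw [h', h] at hl'
      exact absurd rfl hl'.rel
    · exact Subtype.ext (List.cons.inj (h'.symm.trans h)).2
  · refine ⟨⟨i :: l.1, List.isChain_cons.2 ⟨fun j hj hij => h ⟨l.1.tail, ?_⟩, l.2⟩⟩, Or.inl rfl, ?_⟩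
    · rw [hij, List.cons_head?_tail hj]
    · rintro l' (h' | h')
      · exact Subtype.ext h'
      · exact absurd ⟨_, h'⟩ h

/-- The coloring of the tree of reduced words by the letter in which the ends of an edge differ. -/
noncomputable def wordColoring (n : ℕ) : RegularColoring (wordTree n) n where
  color e := e.adj.choose
  bijective l := by
    refine ⟨fun l₁ l₂ h => Subtype.ext ?_, fun i => ?_⟩
    · have hl₂ := l₂.2.choose_spec
      rw [← show l₁.2.choose = l₂.2.choose from h] at hl₂
      exact (existsUnique_eq_cons_or_eq_cons l _).unique l₁.2.choose_spec hl₂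
    · obtain ⟨l', hl', -⟩ := existsUnique_eq_cons_or_eq_cons l i
      have hadj : (wordTree n).Adj l l' := ⟨i, hl'⟩
      exact ⟨⟨l', hadj⟩, eq_of_eq_cons_or_eq_cons hadj.choose_spec hl'⟩

theorem wordColoring_isLegal (n : ℕ) : (wordColoring n).IsLegal := fun e =>
  eq_of_eq_cons_or_eq_cons e.symm.adj.choose_spec e.adj.choose_spec.symm

/-! ### Examples of Frobenius groups -/

section Examples

open MulAction

theorem top_isPretransitive (n : ℕ) :
    IsPretransitive (⊤ : Subgroup (Equiv.Perm (Fin n))) (Fin n) :=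
  ⟨fun i j => ⟨⟨Equiv.swap i j, Subgroup.mem_top _⟩, Equiv.swap_apply_left i j⟩⟩

theorem card_stabilizer_top_three (i : Fin 3) :
    Nat.card (stabilizer (⊤ : Subgroup (Equiv.Perm (Fin 3))) i) = 2 := by
  have := top_isPretransitive 3
  have card_mul_index := (stabilizer (⊤ : Subgroup (Equiv.Perm (Fin 3))) i).card_mul_index
  rw [index_stabilizer_of_transitive, Subgroup.card_top, Nat.card_perm, Nat.card_fin]
    at card_mul_index
  have factorial_three : Nat.factorial 3 = 6 := rfl
  omega

theorem not_actsFreely_of_card_ne_one {n : ℕ} {F : Subgroup (Equiv.Perm (Fin n))} (i : Fin n)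
    (h : Nat.card (stabilizer F i) ≠ 1) : ¬ ActsFreely F := fun hfree =>
  h (Subgroup.card_eq_one.2 (hfree i))

theorem isFrobenius_top_three : IsFrobenius (⊤ : Subgroup (Equiv.Perm (Fin 3))) where
  transitive := top_isPretransitive 3
  not_free := not_actsFreely_of_card_ne_one 0 (by rw [card_stabilizer_top_three]; decide)
  two_point i j hij := by
    have eq_one_of_apply_eq : ∀ (i j : Fin 3) (f : Equiv.Perm (Fin 3)),
        i ≠ j → f i = i → f j = j → f = 1 := by
      decide
    exact (Subgroup.eq_bot_iff_forall _).2 fun f hf =>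
      Subtype.ext (eq_one_of_apply_eq i j f hij hf.1 hf.2)

section AffineGroup

variable {K : Type*} [Field K] {n : ℕ} {ε : K ≃ Fin n} {U : Subgroup Kˣ}

variable (ε U) in
/-- The group of affine permutations of a finite field `K` with multipliers in `U`, which acts on
`Fin n` through an enumeration of `K`. -/
def affineGroup : Subgroup (Equiv.Perm (Fin n)) where
  carrier := {f | ∃ u ∈ U, ∃ b : K, ∀ x, f (ε x) = ε (u * x + b)}
  one_mem' := ⟨1, one_mem _, 0, fun x => by simp⟩
  mul_mem' := by
    rintro f f' ⟨u, hu, b, h⟩ ⟨u', hu', b', h'⟩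
    refine ⟨u * u', mul_mem hu hu', u * b' + b, fun x => ?_⟩
    rw [Equiv.Perm.mul_apply, h', h, Units.val_mul]
    ring_nf
  inv_mem' := by
    rintro f ⟨u, hu, b, h⟩
    refine ⟨u⁻¹, inv_mem hu, -(u⁻¹ * b : K), fun x => ?_⟩
    rw [Equiv.Perm.inv_eq_iff_eq, h, mul_add, mul_neg, Units.mul_inv_cancel_left,
      Units.mul_inv_cancel_left, neg_add_cancel_right]

theorem exists_mem_affineGroup {u : Kˣ} (hu : u ∈ U) (b : K) :
    ∃ f ∈ affineGroup ε U, ∀ x, f (ε x) = ε (u * x + b) := by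
  have hf : ∀ x, ε.permCongr (u.mulLeft.trans (Equiv.addRight b)) (ε x) = ε (u * x + b) :=
    fun x => by simp
  exact ⟨_, ⟨u, hu, b, hf⟩, hf⟩

theorem affineGroup_isPretransitive : IsPretransitive (affineGroup ε U) (Fin n) := by
  refine ⟨fun i j => ?_⟩
  obtain ⟨x, rfl⟩ := ε.surjective i
  obtain ⟨y, rfl⟩ := ε.surjective j
  obtain ⟨f, hf, hfx⟩ := exists_mem_affineGroup (ε := ε) (one_mem U) (y - x)
  refine ⟨⟨f, hf⟩, (hfx x).trans ?_⟩
  rw [Units.val_one, one_mul, add_sub_cancel]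

theorem eq_one_of_mem_affineGroup {f : Equiv.Perm (Fin n)} (hf : f ∈ affineGroup ε U) {i j : Fin n}
    (hij : i ≠ j) (hi : f i = i) (hj : f j = j) : f = 1 := by
  obtain ⟨u, -, b, h⟩ := hf
  obtain ⟨x, rfl⟩ := ε.surjective i
  obtain ⟨y, rfl⟩ := ε.surjective j
  have hxy : x - y ≠ 0 := sub_ne_zero.2 fun h => hij (congrArg ε h)
  have hx := ε.injective ((h x).symm.trans hi)
  have hy := ε.injective ((h y).symm.trans hj)
  have hu : (u : K) = 1 := mul_right_cancel₀ hxy (by linear_combination hx - hy)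
  have hb : b = 0 := by linear_combination hx - x * hu
  refine Equiv.ext fun k => ?_
  obtain ⟨z, rfl⟩ := ε.surjective k
  rw [h, hu, hb, one_mul, add_zero, Equiv.Perm.one_apply]

theorem card_stabilizer_affineGroup (i : Fin n) :
    Nat.card (stabilizer (affineGroup ε U) i) = Nat.card U := by
  obtain ⟨z, rfl⟩ := ε.surjective i
  choose f hf hf_apply using fun u : U =>
    exists_mem_affineGroup (ε := ε) u.2 (z - ((u : Kˣ) : K) * z)
  have f_mem : ∀ u, ⟨f u, hf u⟩ ∈ stabilizer (affineGroup ε U) (ε z) := fun u =>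
    (hf_apply u z).trans (by rw [add_sub_cancel])
  refine (Nat.card_eq_of_bijective (fun u => ⟨⟨f u, hf u⟩, f_mem u⟩) ⟨fun u u' h => ?_, ?_⟩).symm
  · have f_eq : f u = f u' := congrArg (fun g => ((g.1 : affineGroup ε U) : Equiv.Perm (Fin n))) h
    have happly := hf_apply u (z + 1)
    rw [f_eq, hf_apply u'] at happly
    exact Subtype.ext (Units.ext (by linear_combination -ε.injective happly))
  · rintro ⟨⟨g, u, hu, b, h⟩, hgz : g (ε z) = ε z⟩
    refine ⟨⟨u, hu⟩, Subtype.ext (Subtype.ext (Equiv.ext fun k => ?_))⟩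
    obtain ⟨x, rfl⟩ := ε.surjective k
    rw [h] at hgz
    refine (hf_apply ⟨u, hu⟩ x).trans ((h x).trans (congrArg ε ?_)).symm
    linear_combination ε.injective hgz

theorem affineGroup_isFrobenius [Nonempty (Fin n)] (hU : U ≠ ⊥) :
    IsFrobenius (affineGroup ε U) where
  transitive := affineGroup_isPretransitive
  not_free := by
    refine not_actsFreely_of_card_ne_one (Classical.arbitrary _) ?_
    rw [card_stabilizer_affineGroup]
    exact mt Subgroup.card_eq_one.1 hU
  two_point _ _ hij := (Subgroup.eq_bot_iff_forall _).2 fun f hf =>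
    Subtype.ext (eq_one_of_mem_affineGroup f.2 hij hf.1 hf.2)

end AffineGroup

theorem exists_isFrobenius {p : ℕ} (hp : p.Prime) :
    ∃ (n : ℕ) (F : Subgroup (Equiv.Perm (Fin n))), IsFrobenius F ∧
      ∀ i : Fin n, Nat.card (stabilizer F i) = p := by
  obtain ⟨r, hr, -, hmod⟩ := Nat.exists_prime_gt_modEq_one p hp.ne_zero
  have := Fact.mk hr
  have := Fact.mk hp
  have hdvd : p ∣ Nat.card (ZMod r)ˣ := by
    rw [Nat.card_eq_fintype_card, ZMod.card_units]
    exact (Nat.modEq_iff_dvd' hr.one_le).1 hmod.symm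
  obtain ⟨u, hu⟩ := exists_prime_orderOf_dvd_card' p hdvd
  have hU : Subgroup.zpowers u ≠ ⊥ := fun h => hp.ne_one <| by
    rw [← hu, orderOf_eq_one_iff, ← Subgroup.zpowers_eq_bot, h]
  have : Nonempty (Fin r) := ⟨⟨0, hr.pos⟩⟩
  refine ⟨r, affineGroup (ZMod.finEquiv r).symm.toEquiv (Subgroup.zpowers u),
    affineGroup_isFrobenius hU, fun i => ?_⟩
  rw [card_stabilizer_affineGroup, Nat.card_zpowers, hu]

end Examples

/-! ### Subquotients of universal groups -/

section Subquotient

variable {V : Type*} {T : SimpleGraph V} {d : ℕ} {c : RegularColoring T d}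
  {F : Subgroup (Equiv.Perm (Fin d))}

theorem universalGroup_top (c : RegularColoring T d) : universalGroup c ⊤ = ⊤ :=
  eq_top_iff.2 fun _ _ _ => Subgroup.mem_top _

theorem exists_isSimpleSubquotient_three (hT : T.IsTree) (hc : c.IsLegal)
    (hF : ∃ i : Fin d, 2 ∣ Nat.card (MulAction.stabilizer F i))
    {W : Type*} {T₃ : SimpleGraph W} (hT₃ : T₃.IsTree) (hreg : IsRegular T₃ 3) :
    ∃ (H : Subgroup (T ≃g T)) (D : Subgroup H) (_ : D.Normal),
      IsSimpleSubquotient (universalGroup c F) H D ∧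
      Nonempty ((H ⧸ D) ≃ₜ* plus (⊤ : Subgroup (T₃ ≃g T₃))) := by
  obtain ⟨c', hc'⟩ := exists_isLegal hT₃ three_ne_zero hreg
  rw [← universalGroup_top c']
  exact exists_isSimpleSubquotient_plus hT hc Nat.prime_two hF isFrobenius_top_three
    card_stabilizer_top_three hT₃ hc'

theorem exists_isSimpleSubquotient_of_not_actsFreely (hT : T.IsTree) (hc : c.IsLegal)
    (hF : ¬ ActsFreely F) :
    ∃ (H : Subgroup (T ≃g T)) (D : Subgroup H) (_ : D.Normal),
      IsSimpleSubquotient (universalGroup c F) H D ∧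
      ∃ (n : ℕ) (F' : Subgroup (Equiv.Perm (Fin n))) (W : Type) (T' : SimpleGraph W)
        (c' : RegularColoring T' n),
        IsFrobenius F' ∧ T'.IsTree ∧ c'.IsLegal ∧
        Nonempty ((H ⧸ D) ≃ₜ* plus (universalGroup c' F')) := by
  obtain ⟨i, hi⟩ := not_forall.1 hF
  obtain ⟨p, hp, hpi⟩ := Nat.exists_prime_and_dvd (mt Subgroup.card_eq_one.1 hi)
  obtain ⟨n, F', hF', hcard⟩ := exists_isFrobenius hp
  obtain ⟨H, D, hD, h, e⟩ := exists_isSimpleSubquotient_plus hT hc hp ⟨i, hpi⟩ hF' hcard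
    (wordTree_isTree n) (wordColoring_isLegal n)
  exact ⟨H, D, hD, h, n, F', _, _, _, hF', wordTree_isTree n, wordColoring_isLegal n, e⟩

end Subquotient

end BurgerMozes

theorem mainTheorem8_general {V : Type*} (T : SimpleGraph V) (hT : T.IsTree) {d : ℕ}
    (c : BurgerMozes.RegularColoring T d) (hc : c.IsLegal)
    (F : Subgroup (Equiv.Perm (Fin d))) (hF : ¬ BurgerMozes.ActsFreely F) :
    (∃ (H : Subgroup (T ≃g T)) (D : Subgroup H) (_ : D.Normal),
      BurgerMozes.IsSimpleSubquotient (BurgerMozes.universalGroup c F) H D ∧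
      ∃ (n : ℕ) (F' : Subgroup (Equiv.Perm (Fin n))) (W : Type) (T' : SimpleGraph W)
        (c' : BurgerMozes.RegularColoring T' n),
        BurgerMozes.IsFrobenius F' ∧ T'.IsTree ∧ c'.IsLegal ∧
        Nonempty ((H ⧸ D) ≃ₜ* BurgerMozes.plus (BurgerMozes.universalGroup c' F'))) ∧
    ((∃ i : Fin d, 2 ∣ Nat.card (MulAction.stabilizer F i)) →
      ∀ {W : Type*} (T₃ : SimpleGraph W), T₃.IsTree → BurgerMozes.IsRegular T₃ 3 →
      ∃ (H : Subgroup (T ≃g T)) (D : Subgroup H) (_ : D.Normal),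
        BurgerMozes.IsSimpleSubquotient (BurgerMozes.universalGroup c F) H D ∧
        Nonempty ((H ⧸ D) ≃ₜ* BurgerMozes.plus (⊤ : Subgroup (T₃ ≃g T₃)))) ∧
    (∀ p : ℕ, p.Prime → (∃ i : Fin d, p ∣ Nat.card (MulAction.stabilizer F i)) →
      ∀ {n : ℕ} (F' : Subgroup (Equiv.Perm (Fin n))), BurgerMozes.IsFrobenius F' →
      (∀ i : Fin n, Nat.card (MulAction.stabilizer F' i) = p) →
      ∀ {W : Type*} (T' : SimpleGraph W), T'.IsTree →
      ∀ c' : BurgerMozes.RegularColoring T' n, c'.IsLegal →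
      ∃ (H : Subgroup (T ≃g T)) (D : Subgroup H) (_ : D.Normal),
        BurgerMozes.IsSimpleSubquotient (BurgerMozes.universalGroup c F) H D ∧
        Nonempty ((H ⧸ D) ≃ₜ* BurgerMozes.plus (BurgerMozes.universalGroup c' F'))) :=
  ⟨BurgerMozes.exists_isSimpleSubquotient_of_not_actsFreely hT hc hF,
    fun h2 _ _ hT₃ hreg => BurgerMozes.exists_isSimpleSubquotient_three hT hc h2 hT₃ hreg,
    fun _ hp hpF _ _ hF' hcard _ _ hT' _ hc' =>
      BurgerMozes.exists_isSimpleSubquotient_plus hT hc hp hpF hF' hcard hT' hc'⟩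

theorem mainTheorem8 {V : Type*} (T : SimpleGraph V) (hT : T.IsTree) {d : ℕ}
    (c : BurgerMozes.RegularColoring T d) (hc : c.IsLegal)
    (F : Subgroup (Equiv.Perm (Fin d))) (hF : ¬ BurgerMozes.ActsFreely F) :
    -- a subquotient in the class `𝒮`, of the form `Aut(T₃)⁺` or `U(F')⁺` with `F'` Frobenius
    (∃ (H : Subgroup (T ≃g T)) (D : Subgroup H) (_ : D.Normal),
      BurgerMozes.IsSimpleSubquotient (BurgerMozes.universalGroup c F) H D ∧
      ((∃ (W : Type) (T₃ : SimpleGraph W), T₃.IsTree ∧ BurgerMozes.IsRegular T₃ 3 ∧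
          Nonempty ((H ⧸ D) ≃ₜ* BurgerMozes.plus (⊤ : Subgroup (T₃ ≃g T₃)))) ∨
        ∃ (n : ℕ) (F' : Subgroup (Equiv.Perm (Fin n))) (W : Type) (T' : SimpleGraph W)
          (c' : BurgerMozes.RegularColoring T' n),
          BurgerMozes.IsFrobenius F' ∧ T'.IsTree ∧ c'.IsLegal ∧
          Nonempty ((H ⧸ D) ≃ₜ* BurgerMozes.plus (BurgerMozes.universalGroup c' F')))) ∧
    -- the prime 2
    ((∃ i : Fin d, 2 ∣ Nat.card (MulAction.stabilizer F i)) →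
      ∀ {W : Type*} (T₃ : SimpleGraph W), T₃.IsTree → BurgerMozes.IsRegular T₃ 3 →
      ∃ (H : Subgroup (T ≃g T)) (D : Subgroup H) (_ : D.Normal),
        BurgerMozes.IsSimpleSubquotient (BurgerMozes.universalGroup c F) H D ∧
        Nonempty ((H ⧸ D) ≃ₜ* BurgerMozes.plus (⊤ : Subgroup (T₃ ≃g T₃)))) ∧
    -- the odd primes
    (∀ p : ℕ, p.Prime → 2 < p → (∃ i : Fin d, p ∣ Nat.card (MulAction.stabilizer F i)) →
      ∀ {n : ℕ} (F' : Subgroup (Equiv.Perm (Fin n))), BurgerMozes.IsFrobenius F' →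
      (∀ i : Fin n, Nat.card (MulAction.stabilizer F' i) = p) →
      (∀ i : Fin n, ∃ k : ℕ, (MulAction.stabilizer F' i).index = 2 ^ k) →
      ∀ {W : Type*} (T' : SimpleGraph W), T'.IsTree →
      ∀ c' : BurgerMozes.RegularColoring T' n, c'.IsLegal →
      ∃ (H : Subgroup (T ≃g T)) (D : Subgroup H) (_ : D.Normal),
        BurgerMozes.IsSimpleSubquotient (BurgerMozes.universalGroup c F) H D ∧
        Nonempty ((H ⧸ D) ≃ₜ* BurgerMozes.plus (BurgerMozes.universalGroup c' F'))) := by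
  obtain ⟨⟨H, D, hD, h, e⟩, h_two, h_odd⟩ := mainTheorem8_general T hT c hc F hF
  exact ⟨⟨H, D, hD, h, Or.inr e⟩, h_two, fun p hp _ hpF _ F' hF' hcard _ =>
    h_odd p hp hpF F' hF' hcard⟩
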